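/- **Model.** Let $R$ be a commutative ring with identity. Running times are numbers of ring operations: a straight-line program over $R$ is a finite list of instructions, each performing one operation $+$, $-$ or $\times$ on two operands, an operand being an input, a constant, or the result of an earlier instruction; its cost is the number of its instructions. The constants $0,1$ are free, and so are the elements of a fixed set $S\subseteq R$ of precomputed constants ($S$ is arbitrary, possibly empty). Let $\mathsf M,\mathsf{MM}:\mathbf N\to\mathbf N$ be such that, with constants from $S$, two polynomials over $R$ of degree at most $d$ can be multiplied by a program of cost at most $\mathsf M(d)$ for every $d\ge1$, and two $m\times m$ matrices over $R$ can be multiplied by a program of cost at most $\mathsf{MM}(m)$ for every $m$. Suppose that $\mathsf M$ grows regularly: for some constant $A$, $\mathsf M(d)/d\le A\,\mathsf M(e)/e$ for $1\le d\le e$, and $\mathsf M(2d)\le A\,\mathsf M(d)$ for $d\ge1$. For $\alpha,\beta\in R$ and $n,k\in\mathbf N$ put $$ d(\alpha,\beta,n)=\beta\cdot n!\cdot\prod_{j=-n}^{n}(\alpha+j\beta),\qquad \mathsf D(\alpha,\beta,k)=\prod_{i=1}^{\lfloor\log_2k\rfloor}d(\alpha k_i,\beta,k_i)\;d\bigl((k_i+1)\beta,\beta,k_i\bigr),\quad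 k_i=\lfloor k/2^i\rfloor .$$ For an $m\times m$ matrix $M(X)$ of polynomials in $R[X]$ of degree at most $1$ and integers $0\le k<k'$ put $$ M(k,k')=M(k')M(k'-1)\cdots M(k+2)M(k+1). $$ **Theorem.** Let $0<\varepsilon<\frac12$ and let $A$ be a real number. There is a constant $C$, depending only on $\varepsilon$ and $A$, such that the following holds for all $R$, $S$, $\mathsf M$, $\mathsf{MM}$ as above. Let $m\ge0$, $K\ge1$ and $r\geq 0$ be integers with $r<K^{\frac12-\varepsilon}$, let $$ 0\le K_1<L_1\le K_2<L_2\le\cdots\le K_r<L_r\le K $$ be integers, and let $s=\lfloor\log_4K\rfloor$. Suppose that $2,3,\ldots,2^s+1$ are invertible in $R$, and that the inverse $\delta$ of $\mathsf D(1,2^s,2^s)$ is known. Then there is a straight-line program, with constants from $S\cup\{0,1,\delta\}$ and of cost at most $$ C\left(\mathsf{MM}(m)\sqrt K+m^2\,\mathsf M(\lfloor\sqrt K\rfloor)\right), $$ which, given the coefficients of any $m\times m$ matrix $M(X)$ of polynomials in $R[X]$ of degree at most $1$, computes all the entries of $M(K_1,L_1),\ldots,M(K_r,L_r)$. -/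

import Mathlib

open Polynomial

universe u v w

/-! ### The algebraic model of computation: straight-line programs

A running time is a number of ring operations `+`, `-`, `*` in a commutative ring `R`. -/

/-- The three ring operations that are counted. -/
inductive RingOp where
  | add
  | sub
  | mul

/-- The value of a ring operation. -/
def RingOp.apply {R : Type u} [CommRing R] : RingOp → R → R → R
  | .add, a, b => a + b
  | .sub, a, b => a - b
  | .mul, a, b => a * b

/-- An operand of an instruction: a constant of `R`, one of the inputs (indexed by `ι`), or
the result of the `k`-th operation that was performed (counted from `0`). -/
inductive Operand (R : Type u) (ι : Type v) where
  | const (c : R)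
  | input (i : ι)
  | result (k : ℕ)

/-- The value of an operand, given the inputs `x` and the list of the results computed so far.
(A reference to a result that is not there yet reads `0`, a constant that is always free.) -/
def Operand.value {R : Type u} {ι : Type v} [CommRing R] (x : ι → R) (results : List R) :
    Operand R ι → R
  | .const c => c
  | .input i => x i
  | .result k => results.getD k 0

/-- The constants that an operand mentions lie in `S ∪ {0, 1}`. -/
def Operand.ConstantsIn {R : Type u} {ι : Type v} [CommRing R] (S : Set R) :
    Operand R ι → Prop
  | .const c => c = 0 ∨ c = 1 ∨ c ∈ S
  | .input _ => True
  | .result _ => True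

/-- One instruction: one ring operation applied to two operands. -/
structure Instruction (R : Type u) (ι : Type v) where
  op : RingOp
  left : Operand R ι
  right : Operand R ι

/-- A straight-line program over `R` with inputs indexed by `ι` and outputs indexed by `o`. -/
structure StraightLineProgram (R : Type u) (ι : Type v) (o : Type w) where
  code : List (Instruction R ι)
  output : o → Operand R ι

namespace StraightLineProgram

variable {R : Type u} {ι : Type v} {o : Type w}

/-- The number of ring operations that the program performs. -/
def cost (P : StraightLineProgram R ι o) : ℕ := P.code.length

/-- The list of the results of all instructions, in the order of execution. -/
def results [CommRing R] (P : StraightLineProgram R ι o) (x : ι → R) : List R :=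
  P.code.foldl
    (fun mem ins => mem ++ [ins.op.apply (ins.left.value x mem) (ins.right.value x mem)]) []

/-- The outputs of the program on the input `x`. -/
def eval [CommRing R] (P : StraightLineProgram R ι o) (x : ι → R) : o → R :=
  fun j => (P.output j).value x (P.results x)

/-- The program uses no constants except `0`, `1` and elements of `S`. -/
def ConstantsIn [CommRing R] (P : StraightLineProgram R ι o) (S : Set R) : Prop :=
  (∀ ins ∈ P.code, ins.left.ConstantsIn S ∧ ins.right.ConstantsIn S) ∧
    ∀ j, (P.output j).ConstantsIn S

end StraightLineProgram

/-! ### The cost functions for polynomial and matrix multiplication -/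

/-- For every `d ≥ 1`, two polynomials over `R` of degree at most `d` can be multiplied
(coefficients in, coefficients out) with at most `M d` ring operations, using constants
from `S`. -/
def IsPolyMulCost {R : Type u} [CommRing R] (S : Set R) (M : ℕ → ℕ) : Prop :=
  ∀ d : ℕ, 1 ≤ d →
    ∃ P : StraightLineProgram R (Fin (d + 1) ⊕ Fin (d + 1)) (Fin (2 * d + 1)),
      P.ConstantsIn S ∧ P.cost ≤ M d ∧
      ∀ f g : R[X], f.natDegree ≤ d → g.natDegree ≤ d → ∀ k : Fin (2 * d + 1),
        P.eval (Sum.elim (fun i => f.coeff i) (fun i => g.coeff i)) k = (f * g).coeff k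

/-- For every `m`, two `m × m` matrices over `R` can be multiplied with at most `MM m` ring
operations, using constants from `S`. -/
def IsMatMulCost {R : Type u} [CommRing R] (S : Set R) (MM : ℕ → ℕ) : Prop :=
  ∀ m : ℕ,
    ∃ P : StraightLineProgram R ((Fin m × Fin m) ⊕ (Fin m × Fin m)) (Fin m × Fin m),
      P.ConstantsIn S ∧ P.cost ≤ MM m ∧
      ∀ (U V : Matrix (Fin m) (Fin m) R) (a b : Fin m),
        P.eval (Sum.elim (fun p => U p.1 p.2) (fun p => V p.1 p.2)) (a, b) = (U * V) a b

/-- Regular growth of a cost function `M`, with constant `A`: up to the factor `A`, the quotient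
`M d / d` is nondecreasing, and doubling the argument multiplies `M` by at most `A`. -/
structure RegularGrowth (A : ℝ) (M : ℕ → ℕ) : Prop where
  superlinear : ∀ d e : ℕ, 1 ≤ d → d ≤ e → (M d : ℝ) / d ≤ A * ((M e : ℝ) / e)
  doubling : ∀ d : ℕ, 1 ≤ d → (M (2 * d) : ℝ) ≤ A * M d

/-! ### The elements whose inverses are needed -/

/-- `d(α, β, n) = β · 2 ⋯ n · (α - nβ)(α - (n-1)β) ⋯ (α + (n-1)β)(α + nβ)`: its inverse allows
one to pass from the values of a polynomial of degree at most `n` at an arithmetic progression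
of `n + 1` terms with step `β` to its values at the same progression shifted by `α`. -/
def shiftDenominator {R : Type u} [CommRing R] (α β : R) (n : ℕ) : R :=
  β * (n.factorial : R) * ∏ j ∈ Finset.range (2 * n + 1), (α + ((j : R) - (n : R)) * β)

/-- `D(α, β, k) = ∏ d(α kᵢ, β, kᵢ) · d((kᵢ + 1) β, β, kᵢ)`, the product being over
`1 ≤ i ≤ ⌊log₂ k⌋`, where `kᵢ = ⌊k / 2 ^ i⌋`. -/
def bgsD {R : Type u} [CommRing R] (α β : R) (k : ℕ) : R :=
  ∏ i ∈ Finset.Icc 1 (Nat.log 2 k),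
    shiftDenominator (α * ((k / 2 ^ i : ℕ) : R)) β (k / 2 ^ i) *
      shiftDenominator ((((k / 2 ^ i : ℕ) : R) + 1) * β) β (k / 2 ^ i)

/-! ### Products over intervals -/

/-- The value `M(x)` at `x ∈ R` of a matrix `M(X)` of polynomials. -/
def Matrix.evalAt {R : Type u} [CommRing R] {m : ℕ} (N : Matrix (Fin m) (Fin m) R[X]) (x : R) :
    Matrix (Fin m) (Fin m) R :=
  N.map (fun p => p.eval x)

/-- `M(k, l) = M(l) M(l - 1) ⋯ M(k + 2) M(k + 1)`. -/
def intervalProduct {R : Type u} [CommRing R] {m : ℕ} (N : Matrix (Fin m) (Fin m) R[X])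
    (k l : ℕ) : Matrix (Fin m) (Fin m) R :=
  (((List.range' (k + 1) (l - k)).map (fun j : ℕ => N.evalAt (j : R))).reverse).prod

/-! Put t = 2^s, so that t² ≤ K < 4t², and P_k(x) = M(x+k)⋯M(x+1); the entries of P_k are
polynomials in x of degree at most k. Since P_{2k}(x) = P_k(x+k) P_k(x), the values of P_{2k} at 0,
t, …, 2kt follow from those of P_k at 0, t, …, kt by three shifts along the progression and 2k+1
matrix products (`Computes.gridSet_double`). A shift costs one polynomial multiplication, because
Lagrange's formula on an arithmetic progression is a convolution (`eval_shift_eq`). The inverses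
that it needs are those of the factors of D(1, t, t), all obtained from δ in O(t) operations
(`Computes.exists_shiftData`). The costs double from level to level, so the last level dominates.
Carried out for M(X + dt²), d = 0, 1, 2, 3, this gives the blocks of length t at all multiples of t
below 4t².

Each interval consists of aligned blocks and two end pieces shorter than t. The intervals are
disjoint, so there are at most 4t aligned blocks in all. An end piece is cut into fewer than 2^(s-J)
blocks of length 2^J and, by binary expansion of the rest, at most one block of each length 2^i, i <
J. Hence for every i ≤ J the matrix P_{2^i}, known on its grid, is wanted at about r 2^(s-J+1)
arbitrary points, which is a matter of fast interpolation and multipoint evaluation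
(`Computes.multipoint`). If μ bounds M(d)/d, this costs O(m² μ (J+1)² (r 2^(s-J) + 2^J)). As r =
O(2^((1-2ε)s)), the choice J = ⌊(1-ε)s⌋ makes it O(m² μ s² 2^((1-ε)s)), and the saving 2^(-εs)
absorbs the logarithms (`exists_blockSize`).

The algorithm runs on the generic matrix, in the ring of functions of the input: the coordinate
functions are given, and a derivation of the outputs in that ring is a straight-line program
(`Derivable.exists_program`). Conversely the given multiplication programs become derivations
(`StraightLineProgram.derivable`). -/

/-! ### Derivations in a commutative ring -/

/-- `Derivable A n B`: starting from the elements of `A`, at most `n` ring operations produce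
all elements of `B`. -/
inductive Derivable {𝓐 : Type u} [CommRing 𝓐] : Set 𝓐 → ℕ → Set 𝓐 → Prop
  | done {A B : Set 𝓐} {n : ℕ} (h : B ⊆ A) : Derivable A n B
  | step {A B : Set 𝓐} {n : ℕ} (o : RingOp) {a b : 𝓐} (ha : a ∈ A) (hb : b ∈ A)
      (h : Derivable (insert (o.apply a b) A) n B) : Derivable A (n + 1) B

namespace Derivable

variable {𝓐 : Type u} [CommRing 𝓐] {A A' B B' D : Set 𝓐} {n n' : ℕ}

theorem mono_left (h : Derivable A n B) : ∀ {A'}, A ⊆ A' → Derivable A' n B := by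
  induction h with
  | done h => exact fun hA => .done (h.trans hA)
  | step o ha hb _ ih => exact fun hA => .step o (hA ha) (hA hb) (ih (Set.insert_subset_insert hA))

theorem mono_right (h : Derivable A n B) : B' ⊆ B → Derivable A n B' := by
  induction h with
  | done h => exact fun hB => .done (hB.trans h)
  | step o ha hb _ ih => exact fun hB => .step o ha hb (ih hB)

theorem mono_cost (h : Derivable A n B) : ∀ {n'}, n ≤ n' → Derivable A n' B := by
  induction h with
  | done h => exact fun _ => .done h
  | step o ha hb _ ih =>
    intro n' hn
    obtain ⟨k, rfl⟩ : ∃ k, n' = k + 1 := ⟨n' - 1, by omega⟩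
    exact .step o ha hb (ih (by omega))

theorem union_base (h : Derivable A n B) : ∀ {D}, D ⊆ A → Derivable A n (B ∪ D) := by
  induction h with
  | done h => exact fun hD => .done (Set.union_subset h hD)
  | step o ha hb _ ih => exact fun hD => .step o ha hb (ih (hD.trans (Set.subset_insert _ _)))

theorem trans (h : Derivable A n B) :
    ∀ {n' D}, Derivable (A ∪ B) n' D → Derivable A (n + n') (B ∪ D) := by
  induction h with
  | done h =>
    intro n' D h'
    rw [Set.union_eq_left.2 h] at h'
    rw [Set.union_comm]
    exact (h'.union_base h).mono_cost (by omega)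
  | step o ha hb _ ih =>
    intro n' D h'
    have := ih (h'.mono_left (Set.union_subset_union_left _ (Set.subset_insert _ _)))
    exact (Derivable.step o ha hb this).mono_cost (by omega)

end Derivable

/-! ### Straight-line programs and derivations -/

section Programs

variable {R : Type u} [CommRing R] {ι : Type v} {o : Type w}

/-- The results of a list of instructions. -/
def runCode (L : List (Instruction R ι)) (x : ι → R) : List R :=
  L.foldl (fun mem ins => mem ++ [ins.op.apply (ins.left.value x mem) (ins.right.value x mem)]) []

theorem runCode_concat (L : List (Instruction R ι)) (ins : Instruction R ι) (x : ι → R) :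
    runCode (L ++ [ins]) x = runCode L x ++
      [ins.op.apply (ins.left.value x (runCode L x)) (ins.right.value x (runCode L x))] := by
  simp [runCode, List.foldl_append]

theorem runCode_length (L : List (Instruction R ι)) (x : ι → R) :
    (runCode L x).length = L.length := by
  induction L using List.reverseRecOn with
  | nil => simp [runCode]
  | append_singleton L i ih => simp [runCode_concat, ih]

/-- After the code `L` the operand `p` holds the function `a` of the inputs. -/
def Operand.Holds (L : List (Instruction R ι)) (p : Operand R ι) (a : (ι → R) → R) : Prop :=
  (∀ k, p = .result k → k < L.length) ∧ ∀ x, p.value x (runCode L x) = a x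

/-- This is why `Operand.Holds` excludes references to missing results: such a reference reads 0
now, but something else once the code has grown. -/
theorem Operand.Holds.concat {L : List (Instruction R ι)} {p : Operand R ι} {a : (ι → R) → R}
    (h : p.Holds L a) (ins : Instruction R ι) : p.Holds (L ++ [ins]) a := by
  refine ⟨fun k hk => by have := h.1 k hk; simp; omega, fun x => ?_⟩
  rw [← h.2 x]
  cases p with
  | const c => rfl
  | input i => rfl
  | result k =>
    have := h.1 k rfl
    simp only [Operand.value, runCode_concat]
    rw [List.getD_append]
    rwa [runCode_length]

theorem Derivable.exists_code {S : Set R} {A B : Set ((ι → R) → R)} {n : ℕ}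
    (h : Derivable A n B) : ∀ L : List (Instruction R ι),
      (∀ ins ∈ L, ins.left.ConstantsIn S ∧ ins.right.ConstantsIn S) →
      (∀ a ∈ A, ∃ p : Operand R ι, p.ConstantsIn S ∧ p.Holds L a) →
      ∃ L' : List (Instruction R ι),
        (∀ ins ∈ L', ins.left.ConstantsIn S ∧ ins.right.ConstantsIn S) ∧
        L'.length ≤ L.length + n ∧
        ∀ b ∈ B, ∃ p : Operand R ι, p.ConstantsIn S ∧ p.Holds L' b := by
  induction h with
  | done h => exact fun L hL hA => ⟨L, hL, by omega, fun b hb => hA b (h hb)⟩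
  | @step A B n op a b ha hb _ ih =>
    intro L hL hA
    obtain ⟨p, hpS, hp⟩ := hA a ha
    obtain ⟨q, hqS, hq⟩ := hA b hb
    obtain ⟨L', h₁, h₂, h₃⟩ := ih (L ++ [⟨op, p, q⟩]) (by
      intro ins hins
      rcases List.mem_append.1 hins with h | h
      · exact hL ins h
      · rw [List.mem_singleton.1 h]; exact ⟨hpS, hqS⟩) (by
      intro c hc
      rcases hc with rfl | hc
      · refine ⟨.result L.length, trivial, fun k hk => ?_, fun x => ?_⟩
        · cases hk; simp
        · have hl : (runCode L x).length = L.length := runCode_length L x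
          rw [Operand.value, runCode_concat, hp.2, hq.2, List.getD_append_right _ _ _ _ hl.le, hl]
          cases op <;> simp [RingOp.apply]
      · obtain ⟨p', h, h'⟩ := hA c hc
        exact ⟨p', h, h'.concat _⟩)
    exact ⟨L', h₁, by simp at h₂; omega, h₃⟩

/-- A derivation from constants and coordinate functions is a straight-line program. -/
theorem Derivable.exists_program {S : Set R} {A B : Set ((ι → R) → R)} {n : ℕ}
    (h : Derivable A n B)
    (hA : ∀ a ∈ A, (∃ c, (c = 0 ∨ c = 1 ∨ c ∈ S) ∧ a = fun _ => c) ∨ ∃ i, a = fun x => x i)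
    (f : o → (ι → R) → R) (hf : ∀ j, f j ∈ B) :
    ∃ P : StraightLineProgram R ι o, P.ConstantsIn S ∧ P.cost ≤ n ∧
      ∀ x j, P.eval x j = f j x := by
  obtain ⟨L, h₁, h₂, h₃⟩ := h.exists_code (S := S) [] (by simp) (by
    intro a ha
    rcases hA a ha with ⟨c, hc, rfl⟩ | ⟨i, rfl⟩
    · exact ⟨.const c, hc, by simp, fun _ => rfl⟩
    · exact ⟨.input i, trivial, by simp, fun _ => rfl⟩)
  choose p hp hp' using fun j => h₃ (f j) (hf j)
  exact ⟨⟨L, p⟩, ⟨h₁, hp⟩, h₂.trans (by simp), fun x j => (hp' j).2 x⟩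

/-- The operand `p` with the inputs replaced by the functions `y` and the results by `mem`. -/
theorem Operand.exists_mem_value {X : Type w} {S : Set R} {A : Set (X → R)}
    (hA : ∀ c, (c = 0 ∨ c = 1 ∨ c ∈ S) → (fun _ => c) ∈ A) (y : ι → X → R) (hy : ∀ i, y i ∈ A)
    (mem : List (X → R)) (hm : ∀ a ∈ mem, a ∈ A) (p : Operand R ι) (hp : p.ConstantsIn S) :
    ∃ a ∈ A, ∀ x, p.value (fun i => y i x) (mem.map (· x)) = a x := by
  cases p with
  | const c => exact ⟨_, hA c hp, fun _ => rfl⟩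
  | input i => exact ⟨_, hy i, fun _ => rfl⟩
  | result k =>
    by_cases hk : k < mem.length
    · refine ⟨mem[k], hm _ (List.getElem_mem _), fun x => ?_⟩
      simp [Operand.value, hk]
    -- A reference beyond the memory reads the default value 0, a free constant.
    · refine ⟨_, hA 0 (.inl rfl), fun x => ?_⟩
      simp [Operand.value, hk]

/-- A straight-line program, applied to functions, is a derivation. -/
theorem StraightLineProgram.derivable {X : Type w} {S : Set R} {A : Set (X → R)}
    {o : Type*} (P : StraightLineProgram R ι o) (hP : P.ConstantsIn S)
    (hA : ∀ c, (c = 0 ∨ c = 1 ∨ c ∈ S) → (fun _ => c) ∈ A) (y : ι → X → R) (hy : ∀ i, y i ∈ A) :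
    Derivable A P.cost (Set.range fun j x => P.eval (fun i => y i x) j) := by
  have key : ∀ L : List (Instruction R ι),
      (∀ ins ∈ L, ins.left.ConstantsIn S ∧ ins.right.ConstantsIn S) →
      ∃ mem : List (X → R), (∀ x, runCode L (fun i => y i x) = mem.map (· x)) ∧
        Derivable A L.length {a | a ∈ mem} := by
    intro L
    induction L using List.reverseRecOn with
    | nil => exact fun _ => ⟨[], fun x => rfl, .done (by simp)⟩
    | append_singleton L ins ih =>
      intro hL
      obtain ⟨mem, h₁, h₂⟩ := ih (fun i hi => hL i (by simp [hi]))
      have hA' : ∀ c, (c = 0 ∨ c = 1 ∨ c ∈ S) → (fun _ => c) ∈ A ∪ {a | a ∈ mem} :=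
        fun c hc => .inl (hA c hc)
      have hins := hL ins (by simp)
      obtain ⟨a, ha, ha'⟩ := ins.left.exists_mem_value hA' y (fun i => .inl (hy i)) mem
        (fun a h => .inr h) hins.1
      obtain ⟨b, hb, hb'⟩ := ins.right.exists_mem_value hA' y (fun i => .inl (hy i)) mem
        (fun a h => .inr h) hins.2
      refine ⟨mem ++ [ins.op.apply a b], fun x => ?_, ?_⟩
      · rw [runCode_concat, h₁, ha', hb']
        cases ins.op <;> simp [RingOp.apply]
      · have := h₂.trans (.step (n := 0) ins.op ha hb (.done (Set.singleton_subset_iff.2 (.inl rfl))))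
        simp only [List.length_append, List.length_singleton]
        refine this.mono_right ?_
        intro z hz
        rcases List.mem_append.1 hz with h | h
        · exact .inl h
        · exact .inr (by simpa using h)
  obtain ⟨mem, h₁, h₂⟩ := key P.code hP.1
  have := h₂.trans (n' := 0) (D := Set.range fun j x => P.eval (fun i => y i x) j) (.done (by
    rintro _ ⟨j, rfl⟩
    obtain ⟨a, ha, ha'⟩ := (P.output j).exists_mem_value (A := A ∪ {a | a ∈ mem})
      (fun c hc => .inl (hA c hc)) y (fun i => .inl (hy i)) mem (fun a h => .inr h) (hP.2 j)
    convert ha using 1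
    funext x
    rw [← ha', ← h₁]
    rfl))
  exact this.mono_right Set.subset_union_right

end Programs

/-! ### Real-valued cost bounds -/

/-- `Computes A c B`: starting from `A`, at most `c` ring operations produce all of `B`. -/
def Computes {𝓐 : Type u} [CommRing 𝓐] (A : Set 𝓐) (c : ℝ) (B : Set 𝓐) : Prop :=
  ∃ n : ℕ, (n : ℝ) ≤ c ∧ Derivable A n B

namespace Computes

variable {𝓐 : Type u} [CommRing 𝓐] {A A' B B' D : Set 𝓐} {c c' : ℝ}

theorem of_subset (h : B ⊆ A) (hc : 0 ≤ c) : Computes A c B := ⟨0, by simpa using hc, .done h⟩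

theorem mono (h : Computes A c B) (hA : A ⊆ A') (hc : c ≤ c') (hB : B' ⊆ B) :
    Computes A' c' B' := by
  obtain ⟨n, hn, h⟩ := h
  exact ⟨n, hn.trans hc, (h.mono_left hA).mono_right hB⟩

theorem mono_cost (h : Computes A c B) (hc : c ≤ c') : Computes A c' B := h.mono le_rfl hc le_rfl

theorem mono_left (h : Computes A c B) (hA : A ⊆ A') : Computes A' c B := h.mono hA le_rfl le_rfl

theorem mono_right (h : Computes A c B) (hB : B' ⊆ B) : Computes A c B' := h.mono le_rfl le_rfl hB

theorem trans_union (h : Computes A c B) (h' : Computes (A ∪ B) c' D) :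
    Computes A (c + c') (B ∪ D) := by
  obtain ⟨n, hn, h⟩ := h
  obtain ⟨n', hn', h'⟩ := h'
  exact ⟨n + n', by push_cast; linarith, h.trans h'⟩

theorem trans (h : Computes A c B) (h' : Computes (A ∪ B) c' D) : Computes A (c + c') D :=
  (h.trans_union h').mono_right Set.subset_union_right

theorem union (h : Computes A c B) (h' : Computes A c' D) : Computes A (c + c') (B ∪ D) :=
  h.trans_union (h'.mono_left Set.subset_union_left)

theorem op (o : RingOp) {a b : 𝓐} (ha : a ∈ A) (hb : b ∈ A) : Computes A 1 {o.apply a b} :=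
  ⟨1, by simp, .step o ha hb (.done (by simp))⟩

theorem add {a b : 𝓐} (ha : a ∈ A) (hb : b ∈ A) : Computes A 1 {a + b} := op .add ha hb

theorem sub {a b : 𝓐} (ha : a ∈ A) (hb : b ∈ A) : Computes A 1 {a - b} := op .sub ha hb

theorem mul {a b : 𝓐} (ha : a ∈ A) (hb : b ∈ A) : Computes A 1 {a * b} := op .mul ha hb

theorem biUnion {κ : Type*} (s : Finset κ) {f : κ → ℝ} {B : κ → Set 𝓐}
    (h : ∀ i ∈ s, Computes A (f i) (B i)) : Computes A (∑ i ∈ s, f i) (⋃ i ∈ s, B i) := by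
  classical
  induction s using Finset.induction_on with
  | empty => exact of_subset (by simp) (by simp)
  | insert a s ha ih =>
    rw [Finset.sum_insert ha, Finset.set_biUnion_insert]
    exact (h a (by simp)).union (ih fun i hi => h i (by simp [hi]))

theorem iUnion {κ : Type*} [Fintype κ] {B : κ → Set 𝓐}
    (h : ∀ i, Computes A c (B i)) : Computes A (Fintype.card κ * c) (⋃ i, B i) := by
  have := biUnion Finset.univ (f := fun _ => c) (fun i _ => h i)
  simpa using this

theorem iUnion_lt (n : ℕ) {B : ℕ → Set 𝓐} (h : ∀ i < n, Computes A c (B i)) :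
    Computes A (n * c) (⋃ i ∈ Set.Iio n, B i) := by
  have := biUnion (Finset.range n) (f := fun _ => c) (B := B) (fun i hi => h i (by simpa using hi))
  simpa using this

theorem image_lt (n : ℕ) {f : ℕ → 𝓐} (h : ∀ i < n, Computes A c {f i}) :
    Computes A (n * c) (f '' Set.Iio n) := by
  refine (iUnion_lt n h).mono_right ?_
  rintro _ ⟨i, hi, rfl⟩
  exact Set.mem_biUnion hi rfl

theorem iterate (n : ℕ) {B : ℕ → Set 𝓐} (h0 : B 0 ⊆ A)
    (h : ∀ i < n, Computes (A ∪ B i) c (B (i + 1))) : Computes A (n * c) (B n) := by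
  induction n with
  | zero => exact of_subset h0 (by simp)
  | succ n ih =>
    refine ((ih fun i hi => h i (by omega)).trans (h n (by omega))).mono_cost ?_
    push_cast; linarith

theorem sequence (n : ℕ) {f : ℕ → 𝓐} (h : ∀ i < n, Computes (A ∪ f '' Set.Iio i) c {f i}) :
    Computes A (n * c) (f '' Set.Iio n) := by
  refine iterate n (B := fun i => f '' Set.Iio i) (by simp) fun i hi => ?_
  have := of_subset (A := A ∪ f '' Set.Iio i) (B := f '' Set.Iio i) Set.subset_union_right le_rfl
  refine (this.union (h i hi)).mono le_rfl (by simp) ?_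
  rintro _ ⟨j, hj, rfl⟩
  rcases Nat.lt_succ_iff_lt_or_eq.1 (show j < i + 1 from hj) with h | rfl
  · exact .inl ⟨j, h, rfl⟩
  · exact .inr rfl

/-- Sequences whose terms come from the preceding one by a fixed number of operations. -/
theorem recurrence (n : ℕ) {f : ℕ → 𝓐} (h0 : f 0 ∈ A)
    (h : ∀ i < n, Computes (insert (f i) A) c {f (i + 1)}) (hc : 0 ≤ c) :
    Computes A ((n + 1) * c) (f '' Set.Iio (n + 1)) := by
  have := sequence (A := A) (n + 1) (f := f) (c := c) (fun i hi => ?_)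
  · simpa using this
  · cases i with
    | zero => exact of_subset (by simp [h0]) hc
    | succ i =>
      refine (h i (by omega)).mono_left ?_
      exact Set.insert_subset (.inr ⟨i, by simp, rfl⟩) Set.subset_union_left

end Computes

/-! ### Polynomials and matrices -/

section Objects

variable {𝓐 : Type u} {m : ℕ}

/-- The set of the entries of a matrix. -/
def entrySet (U : Matrix (Fin m) (Fin m) 𝓐) : Set 𝓐 := Set.range fun q : Fin m × Fin m => U q.1 q.2

theorem mem_entrySet (U : Matrix (Fin m) (Fin m) 𝓐) (a b : Fin m) : U a b ∈ entrySet U :=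
  ⟨(a, b), rfl⟩

variable [CommRing 𝓐]

/-- The set of the coefficients of a polynomial. -/
def coeffSet (p : 𝓐[X]) : Set 𝓐 := Set.range p.coeff

theorem mem_coeffSet (p : 𝓐[X]) (i : ℕ) : p.coeff i ∈ coeffSet p := ⟨i, rfl⟩

/-- In presence of the constants `Z`, polynomials of degree at most `d ≤ D` can be multiplied
with `μ d` operations. -/
def PolyMulBound (Z : Set 𝓐) (μ : ℝ) (D : ℕ) : Prop :=
  ∀ A : Set 𝓐, Z ⊆ A → ∀ d : ℕ, 1 ≤ d → d ≤ D → ∀ F G : 𝓐[X], F.natDegree ≤ d → G.natDegree ≤ d →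
    coeffSet F ⊆ A → coeffSet G ⊆ A → Computes A (μ * d) (coeffSet (F * G))

/-- In presence of the constants `Z`, two `m × m` matrices can be multiplied with `ν`
operations. -/
def MatMulBound (m : ℕ) (Z : Set 𝓐) (ν : ℝ) : Prop :=
  ∀ A : Set 𝓐, Z ⊆ A → ∀ U V : Matrix (Fin m) (Fin m) 𝓐, entrySet U ⊆ A → entrySet V ⊆ A →
    Computes A ν (entrySet (U * V))

theorem Computes.coeffSet_of_lt {A : Set 𝓐} (h0 : (0 : 𝓐) ∈ A) {c : ℝ} {n : ℕ} {p : 𝓐[X]}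
    (hp : ∀ i, n ≤ i → p.coeff i = 0) (h : ∀ i < n, Computes A c {p.coeff i}) :
    Computes A (n * c) (coeffSet p) := by
  have h₁ := Computes.image_lt n h
  refine (h₁.union (Computes.of_subset (Set.singleton_subset_iff.2 h0) le_rfl)).mono le_rfl
    (by simp) ?_
  rintro _ ⟨i, rfl⟩
  by_cases hi : i < n
  · exact .inl ⟨i, hi, rfl⟩
  · exact .inr (hp i (by omega))

theorem Computes.coeffSet_add {A : Set 𝓐} (h0 : (0 : 𝓐) ∈ A) {d : ℕ} {F G : 𝓐[X]}
    (hF : F.natDegree ≤ d) (hG : G.natDegree ≤ d) (hFA : coeffSet F ⊆ A) (hGA : coeffSet G ⊆ A) :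
    Computes A (d + 1) (coeffSet (F + G)) := by
  have := Computes.coeffSet_of_lt h0 (c := 1) (n := d + 1) (p := F + G) (fun i hi => ?_)
    (fun i _ => by
      rw [coeff_add]
      exact Computes.add (hFA (mem_coeffSet _ _)) (hGA (mem_coeffSet _ _)))
  · simpa using this
  · rw [coeff_add, coeff_eq_zero_of_natDegree_lt (by omega),
      coeff_eq_zero_of_natDegree_lt (by omega), add_zero]

theorem Computes.entrySet_of {A : Set 𝓐} {c : ℝ} {U : Matrix (Fin m) (Fin m) 𝓐}
    (h : ∀ a b, Computes A c {U a b}) : Computes A (m ^ 2 * c) (entrySet U) := by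
  have := Computes.iUnion (κ := Fin m × Fin m) (fun q => h q.1 q.2)
  refine this.mono le_rfl (by simp [sq]) ?_
  rintro _ ⟨q, rfl⟩
  exact Set.mem_iUnion.2 ⟨q, rfl⟩

end Objects

/-! ### Multiplication programs as derivations in a ring of functions -/

section Bounds

variable {R : Type u} [CommRing R] {X : Type v}

/-- The ring operations on functions are pointwise, so the program for R may be checked after
evaluating all coefficients at a point x. -/
theorem IsPolyMulCost.polyMulBound {S : Set R} {M : ℕ → ℕ} (h : IsPolyMulCost S M) {μ : ℝ} {D : ℕ}
    (hM : ∀ d, 1 ≤ d → d ≤ D → (M d : ℝ) ≤ μ * d) {Z : Set (X → R)}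
    (hZ : ∀ c, (c = 0 ∨ c = 1 ∨ c ∈ S) → (fun _ => c) ∈ Z) : PolyMulBound Z μ D := by
  intro A hA d h1 hd F G hF hG hFA hGA
  obtain ⟨P, hP, hc, hE⟩ := h d h1
  have key := P.derivable hP (fun c hc => hA (hZ c hc))
    (Sum.elim (fun i : Fin (d + 1) => F.coeff i) (fun i : Fin (d + 1) => G.coeff i)) (by
      rintro (i | i)
      · exact hFA (mem_coeffSet _ _)
      · exact hGA (mem_coeffSet _ _))
  refine ⟨P.cost + 0, ?_, (key.trans (n' := 0) (D := coeffSet (F * G)) (.done ?_)).mono_right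
    Set.subset_union_right⟩
  · refine le_trans ?_ (hM d h1 hd)
    exact_mod_cast hc
  rintro _ ⟨k, rfl⟩
  by_cases hk : k < 2 * d + 1
  · refine .inr ⟨⟨k, hk⟩, ?_⟩
    funext x
    let φ : (X → R) →+* R := Pi.evalRingHom (fun _ => R) x
    have := hE (F.map φ) (G.map φ) (natDegree_map_le.trans hF) (natDegree_map_le.trans hG) ⟨k, hk⟩
    rw [← Polynomial.map_mul, coeff_map] at this
    refine Eq.trans ?_ this
    refine congrArg (fun z => P.eval z ⟨k, hk⟩) ?_
    funext i
    cases i <;> simp [φ]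
  -- The program outputs only the coefficients up to index 2d; the others are the constant 0.
  · refine .inl (hA ?_)
    rw [coeff_eq_zero_of_natDegree_lt (lt_of_le_of_lt natDegree_mul_le (by omega))]
    exact hZ 0 (.inl rfl)

theorem IsMatMulCost.matMulBound {S : Set R} {MM : ℕ → ℕ} (h : IsMatMulCost S MM) (m : ℕ)
    {Z : Set (X → R)} (hZ : ∀ c, (c = 0 ∨ c = 1 ∨ c ∈ S) → (fun _ => c) ∈ Z) :
    MatMulBound m Z (MM m) := by
  intro A hA U V hU hV
  obtain ⟨P, hP, hc, hE⟩ := h m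
  have key := P.derivable hP (fun c hc => hA (hZ c hc))
    (Sum.elim (fun q : Fin m × Fin m => U q.1 q.2) (fun q : Fin m × Fin m => V q.1 q.2)) (by
      rintro (i | i)
      · exact hU ⟨_, rfl⟩
      · exact hV ⟨_, rfl⟩)
  refine ⟨P.cost, by exact_mod_cast hc, key.mono_right ?_⟩
  rintro _ ⟨⟨a, b⟩, rfl⟩
  refine ⟨(a, b), ?_⟩
  funext x
  have := hE (U.map (· x)) (V.map (· x)) a b
  have h2 : (U.map (· x) * V.map (· x)) a b = (U * V) a b x := by
    simp [Matrix.mul_apply, Finset.sum_apply]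
  rw [h2] at this
  refine Eq.trans ?_ this
  refine congrArg (fun z => P.eval z (a, b)) ?_
  funext i
  cases i <;> simp

end Bounds

/-! ### Lagrange interpolation over a commutative ring -/

section Lagrange

variable {𝓐 : Type u} [CommRing 𝓐]

/-- Over a ring with zero divisors the number of roots is not bounded by the degree. If the
differences of the roots are units, however, X - y n can be split off and the quotient still
vanishes at the other points. -/
theorem eq_zero_of_forall_eval_eq_zero (n : ℕ) (y : ℕ → 𝓐)
    (hy : ∀ i < n, ∀ j < n, i ≠ j → IsUnit (y i - y j)) :
    ∀ f : 𝓐[X], f.natDegree < n → (∀ i < n, f.eval (y i) = 0) → f = 0 := by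
  induction n with
  | zero => intro f hf; omega
  | succ n ih =>
    intro f hf h
    nontriviality 𝓐
    obtain ⟨g, rfl⟩ := dvd_iff_isRoot.2 (h n (by omega))
    by_contra hne
    have hg0 : g ≠ 0 := by rintro rfl; simp at hne
    have hdeg : ((X - C (y n)) * g).natDegree = 1 + g.natDegree := by
      rw [(monic_X_sub_C (y n)).natDegree_mul' hg0, natDegree_X_sub_C]
    have hgy : ∀ i < n, g.eval (y i) = 0 := by
      intro i hi
      have := h i (by omega)
      rw [eval_mul, eval_sub, eval_X, eval_C] at this
      exact (hy i (by omega) n (by omega) (by omega)).mul_right_eq_zero.1 this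
    exact hg0 (ih (fun i hi j hj => hy i (by omega) j (by omega)) g (by omega) hgy)

theorem isUnit_sub_of_prod_erase {n : ℕ} {y u : ℕ → 𝓐}
    (hu : ∀ j < n, u j * ∏ l ∈ (Finset.range n).erase j, (y j - y l) = 1) :
    ∀ i < n, ∀ j < n, i ≠ j → IsUnit (y i - y j) := by
  intro i hi j hj hij
  have h : IsUnit (∏ l ∈ (Finset.range n).erase i, (y i - y l)) :=
    IsUnit.of_mul_eq_one _ (by rw [mul_comm]; exact hu i hi)
  exact isUnit_of_dvd_unit (Finset.dvd_prod_of_mem (fun l => y i - y l)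
    (by simp [hj, hij.symm])) h

/-- The Lagrange polynomial and f have degree less than n and agree at n points with invertible
differences. The inverses are supplied as weights u j, since division is not an operation. -/
theorem eval_eq_sum_lagrange {n : ℕ} {y u : ℕ → 𝓐}
    (hu : ∀ j < n, u j * ∏ l ∈ (Finset.range n).erase j, (y j - y l) = 1)
    {f : 𝓐[X]} (hf : f.natDegree < n) (x : 𝓐) :
    f.eval x = ∑ j ∈ Finset.range n, f.eval (y j) * u j *
      ∏ l ∈ (Finset.range n).erase j, (x - y l) := by
  set g : 𝓐[X] := ∑ j ∈ Finset.range n, C (f.eval (y j) * u j) *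
      ∏ l ∈ (Finset.range n).erase j, (X - C (y l)) with hg
  have hgdeg : g.natDegree < n := by
    refine lt_of_le_of_lt (natDegree_sum_le_of_forall_le _ _ (n := n - 1) fun j hj => ?_) (by omega)
    refine (natDegree_C_mul_le _ _).trans ((natDegree_prod_le _ _).trans ?_)
    refine (Finset.sum_le_card_nsmul _ _ 1 fun l _ => natDegree_X_sub_C_le _).trans ?_
    rw [Finset.card_erase_of_mem hj]
    simp
  have key : f - g = 0 := by
    refine eq_zero_of_forall_eval_eq_zero n y (isUnit_sub_of_prod_erase hu) _
      (lt_of_le_of_lt (natDegree_sub_le _ _) (max_lt hf hgdeg)) fun i hi => ?_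
    rw [eval_sub, hg, eval_finsetSum, Finset.sum_eq_single i]
    · rw [eval_mul, eval_C, eval_prod]
      simp only [eval_sub, eval_X, eval_C]
      rw [mul_assoc, hu i hi, mul_one, sub_self]
    · intro j _ hj
      rw [eval_mul, eval_prod, Finset.prod_eq_zero (i := i)]
      · simp
      · simp [hi, hj.symm]
      · simp
    · simp [hi]
  rw [sub_eq_zero.1 key, hg, eval_finsetSum]
  refine Finset.sum_congr rfl fun j _ => ?_
  rw [eval_mul, eval_C, eval_prod]
  simp only [eval_sub, eval_X, eval_C]
  rw [← hg, ← sub_eq_zero.1 key]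

end Lagrange

/-! ### Shifting values along an arithmetic progression -/

section Shift

variable {𝓐 : Type u} [CommRing 𝓐]

/-- The polynomial of degree less than `n` with the coefficients `a 0, …, a (n - 1)`. -/
noncomputable def seqPoly (n : ℕ) (a : ℕ → 𝓐) : 𝓐[X] := ∑ j ∈ Finset.range n, C (a j) * X ^ j

theorem seqPoly_coeff (n : ℕ) (a : ℕ → 𝓐) (i : ℕ) :
    (seqPoly n a).coeff i = if i < n then a i else 0 := by
  simp [seqPoly, coeff_C_mul, coeff_X_pow]

theorem seqPoly_natDegree_le {n d : ℕ} (a : ℕ → 𝓐) (h : n ≤ d + 1) :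
    (seqPoly n a).natDegree ≤ d := by
  rw [natDegree_le_iff_coeff_eq_zero]
  intro i hi
  rw [seqPoly_coeff, if_neg (by omega)]

theorem coeffSet_seqPoly_subset {A : Set 𝓐} (h0 : (0 : 𝓐) ∈ A) {n : ℕ} {a : ℕ → 𝓐}
    (ha : ∀ i < n, a i ∈ A) : coeffSet (seqPoly n a) ⊆ A := by
  rintro _ ⟨i, rfl⟩
  rw [seqPoly_coeff]
  split_ifs with h
  exacts [ha i h, h0]

theorem prod_window_reflect (k i : ℕ) (α β : 𝓐) :
    ∏ l ∈ Finset.range (k + 1), (α + (i : 𝓐) * β - (l : 𝓐) * β) =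
      ∏ e ∈ Finset.range (k + 1), (α + (((i + e : ℕ) : 𝓐) - (k : 𝓐)) * β) := by
  rw [← Finset.prod_range_reflect]
  refine Finset.prod_congr rfl fun e he => ?_
  rw [Finset.mem_range] at he
  rw [show k + 1 - 1 - e = k - e by omega, Nat.cast_sub (by omega)]
  push_cast
  ring

/-- At α + iβ, the product over l ≠ j in Lagrange's formula is the full product, independent of j,
divided by α + (i-j)β. What remains is a sum of f(jβ) u_j times a function of i - j, that is, a
convolution; the offset k makes the index i + k - j of w nonnegative. -/
theorem eval_shift_eq {k : ℕ} {α β : 𝓐} {u w : ℕ → 𝓐}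
    (hu : ∀ j < k + 1, u j * ∏ l ∈ (Finset.range (k + 1)).erase j,
      ((j : 𝓐) * β - (l : 𝓐) * β) = 1)
    (hw : ∀ e < 2 * k + 1, w e * (α + ((e : 𝓐) - (k : 𝓐)) * β) = 1)
    {f : 𝓐[X]} (hf : f.natDegree ≤ k) {i : ℕ} (hi : i < k + 1) :
    f.eval (α + (i : 𝓐) * β) =
      (∏ e ∈ Finset.range (k + 1), (α + (((i + e : ℕ) : 𝓐) - (k : 𝓐)) * β)) *
      (seqPoly (k + 1) (fun j => f.eval ((j : 𝓐) * β) * u j) * seqPoly (2 * k + 1) w).coeff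
        (i + k) := by
  rw [eval_eq_sum_lagrange (y := fun j => (j : 𝓐) * β) hu (Nat.lt_succ_of_le hf), coeff_mul,
    Finset.Nat.sum_antidiagonal_eq_sum_range_succ_mk,
    ← Finset.sum_subset (Finset.range_mono (show k + 1 ≤ (i + k).succ by omega)), Finset.mul_sum]
  · refine Finset.sum_congr rfl fun j hj => ?_
    rw [Finset.mem_range] at hj
    rw [seqPoly_coeff, seqPoly_coeff, if_pos hj, if_pos (by omega), ← prod_window_reflect,
      ← Finset.mul_prod_erase _ _ (Finset.mem_range.2 hj)]
    have h := hw (i + k - j) (by omega)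
    rw [Nat.cast_sub (by omega)] at h
    have h' : w (i + k - j) * (α + (i : 𝓐) * β - (j : 𝓐) * β) = 1 := by
      rw [← h]; push_cast; ring
    linear_combination (-(f.eval ((j : 𝓐) * β) * u j *
      ∏ l ∈ (Finset.range (k + 1)).erase j, (α + (i : 𝓐) * β - (l : 𝓐) * β))) * h'
  · intro j _ hj
    rw [Finset.mem_range, not_lt] at hj
    simp only [seqPoly_coeff]
    rw [if_neg (by omega), zero_mul]

theorem Computes.prefixProds {A : Set 𝓐} (h1 : (1 : 𝓐) ∈ A) (n : ℕ) {f : ℕ → 𝓐}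
    (hf : ∀ i < n, f i ∈ A) :
    Computes A (n + 1) ((fun j => ∏ i ∈ Finset.range j, f i) '' Set.Iio (n + 1)) := by
  have := Computes.recurrence (A := A) (c := 1) n (f := fun j => ∏ i ∈ Finset.range j, f i)
    (by simpa using h1) (fun i hi => ?_) zero_le_one
  · simpa using this
  · simp only [Finset.prod_range_succ]
    exact Computes.mul (Set.mem_insert _ _) (.inr (hf i hi))

/-- The window slides: the next product is the present one times the entering factor and the inverse
of the leaving one. Only the first window is multiplied out. -/
theorem Computes.windowProds {A : Set 𝓐} (h1 : (1 : 𝓐) ∈ A) (k : ℕ) {v w : ℕ → 𝓐}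
    (hv : ∀ e < 2 * k + 1, v e ∈ A) (hw : ∀ e < 2 * k + 1, w e ∈ A)
    (hwv : ∀ e < 2 * k + 1, w e * v e = 1) :
    Computes A (3 * k + 4)
      ((fun i => ∏ e ∈ Finset.range (k + 1), v (i + e)) '' Set.Iio (k + 1)) := by
  have h := Computes.prefixProds h1 (k + 1) (f := v) (fun i hi => hv i (by omega))
  refine (h.trans (Computes.recurrence (c := 2) k ?_ (fun i hi => ?_) zero_le_two)).mono_cost ?_
  · refine .inr ⟨k + 1, by simp, by simp⟩
  · set B := insert (∏ e ∈ Finset.range (k + 1), v (i + e))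
      (A ∪ (fun j => ∏ i ∈ Finset.range j, v i) '' Set.Iio (k + 1 + 1)) with hB
    have hAB : A ⊆ B := fun x hx => .inr (.inl hx)
    have h1 : Computes B 1 {(∏ e ∈ Finset.range (k + 1), v (i + e)) * v (i + (k + 1))} :=
      Computes.mul (.inl rfl) (hAB (hv _ (by omega)))
    have h2 := h1.trans (Computes.mul (a := (∏ e ∈ Finset.range (k + 1), v (i + e)) *
      v (i + (k + 1))) (b := w i) (.inr rfl) (.inl (hAB (hw _ (by omega)))))
    refine h2.mono le_rfl (by norm_num) ?_
    rw [Set.singleton_subset_iff, Set.mem_singleton_iff, ← Finset.prod_range_succ,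
      Finset.prod_range_succ' (fun e => v (i + e)), mul_assoc, mul_comm (v (i + 0)), add_zero, hwv i (by omega), mul_one]
    exact Finset.prod_congr rfl fun e _ => by congr 1; omega
  · push_cast; linarith

theorem Computes.shift {Z A : Set 𝓐} {μ : ℝ} {D : ℕ} (hM : PolyMulBound Z μ D) (hμ : 1 ≤ μ)
    (hZA : Z ⊆ A) (h0 : (0 : 𝓐) ∈ A) (h1 : (1 : 𝓐) ∈ A) {k : ℕ} (hk : 1 ≤ k) (hkD : 2 * k ≤ D)
    {α β : 𝓐} {u w : ℕ → 𝓐}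
    (hu : ∀ j < k + 1, u j * ∏ l ∈ (Finset.range (k + 1)).erase j,
      ((j : 𝓐) * β - (l : 𝓐) * β) = 1)
    (hw : ∀ e < 2 * k + 1, w e * (α + ((e : 𝓐) - (k : 𝓐)) * β) = 1)
    (huA : ∀ j < k + 1, u j ∈ A) (hwA : ∀ e < 2 * k + 1, w e ∈ A)
    (hvA : ∀ e < 2 * k + 1, α + ((e : 𝓐) - (k : 𝓐)) * β ∈ A)
    {f : 𝓐[X]} (hf : f.natDegree ≤ k) (hfA : ∀ j < k + 1, f.eval ((j : 𝓐) * β) ∈ A) :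
    Computes A (15 * μ * k) ((fun i : ℕ => f.eval (α + (i : 𝓐) * β)) '' Set.Iio (k + 1)) := by
  have s₁ : Computes A ((k + 1 : ℕ) * 1)
      ((fun j : ℕ => f.eval ((j : 𝓐) * β) * u j) '' Set.Iio (k + 1)) :=
    Computes.image_lt (k + 1) fun j hj => Computes.mul (hfA j hj) (huA j hj)
  set A₁ := A ∪ (fun j : ℕ => f.eval ((j : 𝓐) * β) * u j) '' Set.Iio (k + 1)
  have hA₁ : A ⊆ A₁ := Set.subset_union_left
  have s₂ := hM A₁ (hZA.trans hA₁) (2 * k) (by omega) hkD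
    (seqPoly (k + 1) fun j => f.eval ((j : 𝓐) * β) * u j) (seqPoly (2 * k + 1) w)
    (seqPoly_natDegree_le _ (by omega)) (seqPoly_natDegree_le _ le_rfl)
    (coeffSet_seqPoly_subset (hA₁ h0) fun j hj => .inr ⟨j, hj, rfl⟩)
    (coeffSet_seqPoly_subset (hA₁ h0) fun e he => hA₁ (hwA e he))
  have s₃ := (s₁.trans s₂).union (Computes.windowProds h1 k hvA hwA hw)
  have s₄ := s₃.trans (Computes.image_lt (c := 1) (k + 1)
    (f := fun i : ℕ => f.eval (α + (i : 𝓐) * β)) fun i hi => ?_)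
  · refine s₄.mono_cost ?_
    -- The multiplication in degree 2k costs 2μk; the linear terms are absorbed because 1 ≤ μ and 1
    -- ≤ k.
    have hk' : (1 : ℝ) ≤ k := by exact_mod_cast hk
    push_cast
    nlinarith [mul_nonneg (sub_nonneg.2 hμ) (sub_nonneg.2 hk')]
  · simp only [eval_shift_eq hu hw hf hi]
    exact Computes.mul (.inr (.inr ⟨i, hi, rfl⟩)) (.inr (.inl (mem_coeffSet _ _)))

end Shift

/-! ### Inverses from the inverse of a product -/

section Inverses

variable {𝓐 : Type u} [CommRing 𝓐]

theorem Computes.suffixProds {A : Set 𝓐} (h1 : (1 : 𝓐) ∈ A) (L : List 𝓐) (hL : ∀ x ∈ L, x ∈ A) :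
    Computes A L.length {p | ∃ L', L' <:+ L ∧ p = L'.prod} := by
  induction L with
  | nil => exact Computes.of_subset (by rintro _ ⟨L', h, rfl⟩; simpa [List.suffix_nil.1 h]) (by simp)
  | cons x L ih =>
    have := (ih fun y hy => hL y (by simp [hy])).trans_union
      (Computes.mul (a := x) (b := L.prod) (.inl (hL x (by simp)))
        (.inr ⟨L, List.suffix_rfl, rfl⟩))
    refine this.mono le_rfl (by simp) ?_
    rintro _ ⟨L', h, rfl⟩
    rcases List.suffix_cons_iff.1 h with rfl | h
    · exact .inr (by simp)
    · exact .inl ⟨L', h, rfl⟩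

/-- Simultaneous inversion: if δ inverts x · L.prod, then δ · L.prod inverts x and δ · x inverts
L.prod, so each factor takes two multiplications once the suffix products are known. -/
theorem Computes.inverses_of_suffixProds (L : List 𝓐) : ∀ {A : Set 𝓐} (_ : ∀ x ∈ L, x ∈ A)
    (_ : {p | ∃ L', L' <:+ L ∧ p = L'.prod} ⊆ A) {δ : 𝓐} (_ : δ ∈ A) (_ : δ * L.prod = 1),
    Computes A (2 * L.length) {y | ∃ x ∈ L, y * x = 1} := by
  induction L with
  | nil => intros; exact Computes.of_subset (by simp) (by simp)
  | cons x L ih =>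
    intro A hL hs δ hδA hδ
    rw [List.prod_cons] at hδ
    have h₁ : Computes A 1 {δ * L.prod} :=
      Computes.mul hδA (hs ⟨L, List.suffix_cons x L, rfl⟩)
    have h₂ : Computes A 1 {δ * x} := Computes.mul hδA (hL x (by simp))
    have h₃ := h₂.trans (ih (A := A ∪ {δ * x}) (fun y hy => .inl (hL y (by simp [hy])))
      (fun p ⟨L', h, hp⟩ => .inl (hs ⟨L', h.trans (List.suffix_cons x L), hp⟩))
      (.inr rfl) (by rw [mul_assoc, hδ]))
    refine (h₁.union h₃).mono le_rfl (by simp; linarith) ?_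
    rintro y ⟨z, hz, hyz⟩
    rcases List.mem_cons.1 hz with rfl | hz
    · refine .inl ?_
      rw [Set.mem_singleton_iff]
      -- Inverses are unique, so y is the computed element δ · L.prod.
      linear_combination (-y) * hδ + δ * L.prod * hyz
    · exact .inr ⟨z, hz, hyz⟩

/-- The inverses of all factors of a product, from the inverse of the product. -/
theorem Computes.inverses {A : Set 𝓐} (h1 : (1 : 𝓐) ∈ A) (L : List 𝓐) (hL : ∀ x ∈ L, x ∈ A)
    {δ : 𝓐} (hδA : δ ∈ A) (hδ : δ * L.prod = 1) :
    Computes A (3 * L.length) {y | ∃ x ∈ L, y * x = 1} := by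
  refine ((Computes.suffixProds h1 L hL).trans (Computes.inverses_of_suffixProds L
    (fun x hx => .inl (hL x hx)) Set.subset_union_right (.inl hδA) hδ)).mono_cost ?_
  linarith

theorem exists_mul_eq_one_of_mem {L : List 𝓐} {δ x : 𝓐} (hδ : δ * L.prod = 1) (hx : x ∈ L) :
    ∃ y, y * x = 1 := by
  obtain ⟨z, hz⟩ := List.dvd_prod hx
  exact ⟨δ * z, by rw [← hδ, hz]; ring⟩

/-- The nodes below j contribute β^j j!, those above j contribute (-β)^(k-j) (k-j)!. The factorials
stay written as products, to be cancelled factor by factor. -/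
theorem prod_sub_erase (k j : ℕ) (hj : j < k + 1) (β : 𝓐) :
    ∏ l ∈ (Finset.range (k + 1)).erase j, ((j : 𝓐) * β - (l : 𝓐) * β) =
      β ^ k * (∏ i ∈ Finset.range j, ((i : 𝓐) + 1)) *
        ∏ i ∈ Finset.range (k - j), (-((i : 𝓐) + 1)) := by
  have hs : (Finset.range (k + 1)).erase j =
      Finset.range j ∪ Finset.Ico (j + 1) (k + 1) := by
    ext l; simp only [Finset.mem_erase, Finset.mem_range, Finset.mem_union, Finset.mem_Ico]; omega
  have hd : Disjoint (Finset.range j) (Finset.Ico (j + 1) (k + 1)) := by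
    rw [Finset.disjoint_left]; intro l; simp only [Finset.mem_range, Finset.mem_Ico]; omega
  have e₁ : ∏ l ∈ Finset.range j, ((j : 𝓐) * β - (l : 𝓐) * β) =
      β ^ j * ∏ i ∈ Finset.range j, ((i : 𝓐) + 1) := by
    rw [← Finset.prod_range_reflect, ← Finset.card_range j, ← Finset.prod_const, Finset.card_range,
      ← Finset.prod_mul_distrib]
    refine Finset.prod_congr rfl fun i hi => ?_
    rw [Finset.mem_range] at hi
    have : ((j - 1 - i : ℕ) : 𝓐) = (j : 𝓐) - 1 - i := by
      rw [Nat.cast_sub (by omega), Nat.cast_sub (by omega)]; simp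
    rw [this]; ring
  have e₂ : ∏ l ∈ Finset.Ico (j + 1) (k + 1), ((j : 𝓐) * β - (l : 𝓐) * β) =
      β ^ (k - j) * ∏ i ∈ Finset.range (k - j), (-((i : 𝓐) + 1)) := by
    rw [Finset.prod_Ico_eq_prod_range, show k + 1 - (j + 1) = k - j by omega]
    conv_rhs => rw [← Finset.card_range (k - j), ← Finset.prod_const, Finset.card_range,
      ← Finset.prod_mul_distrib]
    refine Finset.prod_congr rfl fun i _ => ?_
    push_cast; ring
  rw [hs, Finset.prod_union hd, e₁, e₂]
  obtain ⟨c, rfl⟩ : ∃ c, k = j + c := ⟨k - j, by omega⟩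
  rw [Nat.add_sub_cancel_left, pow_add]
  ring

/-- The weights are β^(-k) / (j! (-1)^(k-j) (k-j)!). All of them are assembled from prefix products
of the inverses of β, of i + 1 and of -(i + 1), hence in linear time. -/
theorem Computes.lagrangeWeights {A : Set 𝓐} (h0 : (0 : 𝓐) ∈ A) (h1 : (1 : 𝓐) ∈ A) {k : ℕ}
    (hk : 1 ≤ k) {τ β : 𝓐} (hτA : τ ∈ A) (hτ : τ * β = 1) {y : ℕ → 𝓐} (hyA : ∀ i < k, y i ∈ A)
    (hy : ∀ i < k, y i * ((i : 𝓐) + 1) = 1) :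
    ∃ u : ℕ → 𝓐, (∀ j < k + 1, u j * ∏ l ∈ (Finset.range (k + 1)).erase j,
      ((j : 𝓐) * β - (l : 𝓐) * β) = 1) ∧ Computes A (12 * k) (u '' Set.Iio (k + 1)) := by
  refine ⟨fun j => τ ^ k * (∏ i ∈ Finset.range j, y i) * ∏ i ∈ Finset.range (k - j), (0 - y i),
    fun j hj => ?_, ?_⟩
  · rw [prod_sub_erase k j hj]
    have e₁ : (∏ i ∈ Finset.range j, y i) * ∏ i ∈ Finset.range j, ((i : 𝓐) + 1) = 1 := by
      rw [← Finset.prod_mul_distrib]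
      exact Finset.prod_eq_one fun i hi => hy i (by rw [Finset.mem_range] at hi; omega)
    have e₂ : (∏ i ∈ Finset.range (k - j), (0 - y i)) *
        ∏ i ∈ Finset.range (k - j), (-((i : 𝓐) + 1)) = 1 := by
      rw [← Finset.prod_mul_distrib]
      refine Finset.prod_eq_one fun i hi => ?_
      rw [Finset.mem_range] at hi
      linear_combination hy i (by omega)
    calc _ = (τ * β) ^ k * ((∏ i ∈ Finset.range j, y i) * ∏ i ∈ Finset.range j, ((i : 𝓐) + 1)) *
          ((∏ i ∈ Finset.range (k - j), (0 - y i)) *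
            ∏ i ∈ Finset.range (k - j), (-((i : 𝓐) + 1))) := by rw [mul_pow]; ring
      _ = 1 := by rw [e₁, e₂, hτ]; simp
  · have s₁ := Computes.prefixProds h1 k (f := fun _ => τ) fun _ _ => hτA
    have s₂ := Computes.prefixProds h1 k (f := y) hyA
    have s₃ := (Computes.image_lt (A := A) (c := 1) k (f := fun i => 0 - y i)
      fun i hi => Computes.sub h0 (hyA i hi))
    have s₄ := s₃.trans (Computes.prefixProds (.inl h1) k (f := fun i => 0 - y i)
      fun i hi => .inr ⟨i, hi, rfl⟩)
    have s₅ := (s₁.union s₂).union s₄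
    refine (s₅.trans (Computes.image_lt (c := 1 + 1) (k + 1) fun j hj => ?_)).mono_cost ?_
    · refine (Computes.mul (a := τ ^ k) (b := ∏ i ∈ Finset.range j, y i)
        (.inr (.inl (.inl ⟨k, by simp, by simp⟩)))
        (.inr (.inl (.inr ⟨j, hj, rfl⟩)))).trans (Computes.mul (.inr rfl)
          (.inl (.inr (.inr ⟨k - j, ?_, rfl⟩))))
      rw [Set.mem_Iio]; omega
    · have hk' : (1 : ℝ) ≤ k := by exact_mod_cast hk
      push_cast; linarith

theorem Computes.naturals {A : Set 𝓐} (h0 : (0 : 𝓐) ∈ A) (h1 : (1 : 𝓐) ∈ A) (n : ℕ) :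
    Computes A (n + 1) ((fun j : ℕ => (j : 𝓐)) '' Set.Iio (n + 1)) := by
  have := Computes.recurrence (A := A) (c := 1) n (f := fun j : ℕ => (j : 𝓐)) (by simpa using h0)
    (fun i _ => by
      simp only [Nat.cast_succ]
      exact Computes.add (.inl rfl) (.inr h1)) zero_le_one
  simpa using this

/-- The factors of `shiftDenominator α β n`. -/
def shiftFactors (α β : 𝓐) (n : ℕ) : List 𝓐 :=
  β :: ((List.range n).map (fun j : ℕ => (j : 𝓐) + 1) ++
    (List.range (2 * n + 1)).map fun j : ℕ => α + ((j : 𝓐) - (n : 𝓐)) * β)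

theorem shiftFactors_prod (α β : 𝓐) (n : ℕ) :
    (shiftFactors α β n).prod = shiftDenominator α β n := by
  have h : ((List.range n).map fun j : ℕ => (j : 𝓐) + 1).prod = (n.factorial : 𝓐) := by
    rw [← Finset.prod_range_add_one_eq_factorial, Nat.cast_prod,
      ← List.prod_toFinset _ List.nodup_range, List.toFinset_range]
    simp
  have h' : ((List.range (2 * n + 1)).map fun j : ℕ => α + ((j : 𝓐) - (n : 𝓐)) * β).prod =
      ∏ j ∈ Finset.range (2 * n + 1), (α + ((j : 𝓐) - (n : 𝓐)) * β) := by
    rw [← List.prod_toFinset _ List.nodup_range, List.toFinset_range]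
  rw [shiftFactors, List.prod_cons, List.prod_append, h, h', shiftDenominator, mul_assoc]

theorem shiftFactors_length (α β : 𝓐) (n : ℕ) : (shiftFactors α β n).length = 3 * n + 2 := by
  simp [shiftFactors]; omega

/-- The factors of `bgsD 1 (2 ^ s) (2 ^ s)`. -/
def bgsFactors (𝓐 : Type u) [CommRing 𝓐] (s : ℕ) : List 𝓐 :=
  (List.range s).flatMap fun i =>
    shiftFactors ((2 ^ i : ℕ) : 𝓐) ((2 ^ s : ℕ) : 𝓐) (2 ^ i) ++
      shiftFactors ((((2 ^ i : ℕ) : 𝓐) + 1) * ((2 ^ s : ℕ) : 𝓐)) ((2 ^ s : ℕ) : 𝓐) (2 ^ i)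

theorem bgsFactors_prod (s : ℕ) :
    (bgsFactors 𝓐 s).prod = bgsD 1 (2 ^ s) (2 ^ s) := by
  rw [bgsFactors, List.flatMap, List.prod_flatten, List.map_map, bgsD, Nat.log_pow (by norm_num),
    ← List.prod_toFinset _ List.nodup_range, List.toFinset_range]
  -- For k = 2^s one has k_i = 2^(s-i): the two products run in opposite orders.
  refine Finset.prod_bij' (fun i _ => s - i) (fun i _ => s - i) ?_ ?_ ?_ ?_ ?_
  · intro i hi; simp only [Finset.mem_range, Finset.mem_Icc] at *; omega
  · intro i hi; simp only [Finset.mem_range, Finset.mem_Icc] at *; omega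
  · intro i hi; simp only [Finset.mem_range] at *; omega
  · intro i hi; simp only [Finset.mem_Icc] at *; omega
  · intro i hi
    rw [Finset.mem_range] at hi
    have : 2 ^ s / 2 ^ (s - i) = 2 ^ i := by
      rw [Nat.pow_div (by omega) (by norm_num)]; congr 1; omega
    simp [this, shiftFactors_prod, List.prod_append]

/-- The geometric growth in i keeps the number of factors linear in 2^s, without a logarithm. -/
theorem bgsFactors_length (s : ℕ) : (bgsFactors 𝓐 s).length ≤ 10 * 2 ^ s := by
  have h : (bgsFactors 𝓐 s).length = ∑ i ∈ Finset.range s, (6 * 2 ^ i + 4) := by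
    rw [bgsFactors, List.length_flatMap, ← List.sum_toFinset _ List.nodup_range,
      List.toFinset_range]
    refine Finset.sum_congr rfl fun i _ => ?_
    rw [List.length_append, shiftFactors_length, shiftFactors_length]
    ring
  have h2 := Nat.geomSum_eq (m := 2) le_rfl s
  have h3 : s < 2 ^ s := Nat.lt_two_pow_self
  rw [h, Finset.sum_add_distrib, ← Finset.mul_sum, h2]
  simp
  omega

end Inverses

/-! ### Precomputation of the inverses and the interpolation weights -/

section Preparation

variable {𝓐 : Type u} [CommRing 𝓐]

/-- The elements that are needed to shift the values of a polynomial of degree at most `k` at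
`0, β, …, kβ` by `k` and by `(k + 1)β`. -/
structure ShiftData (T : Set 𝓐) (β : 𝓐) (k : ℕ) where
  u : ℕ → 𝓐
  near : ℕ → 𝓐
  far : ℕ → 𝓐
  u_mul : ∀ j < k + 1, u j * ∏ l ∈ (Finset.range (k + 1)).erase j,
      ((j : 𝓐) * β - (l : 𝓐) * β) = 1
  near_mul : ∀ e < 2 * k + 1, near e * ((k : 𝓐) + ((e : 𝓐) - (k : 𝓐)) * β) = 1
  far_mul : ∀ e < 2 * k + 1, far e * (((k : 𝓐) + 1) * β + ((e : 𝓐) - (k : 𝓐)) * β) = 1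
  u_mem : ∀ j < k + 1, u j ∈ T
  near_mem : ∀ e < 2 * k + 1, near e ∈ T
  far_mem : ∀ e < 2 * k + 1, far e ∈ T
  near_arg_mem : ∀ e < 2 * k + 1, (k : 𝓐) + ((e : 𝓐) - (k : 𝓐)) * β ∈ T
  far_arg_mem : ∀ e < 2 * k + 1, ((k : 𝓐) + 1) * β + ((e : 𝓐) - (k : 𝓐)) * β ∈ T

theorem Computes.list {A : Set 𝓐} {c : ℝ} (L : List 𝓐) (h : ∀ x ∈ L, Computes A c {x}) :
    Computes A (L.length * c) {x | x ∈ L} := by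
  induction L with
  | nil => exact Computes.of_subset (by simp) (by simp)
  | cons x L ih =>
    refine ((h x (by simp)).union (ih fun y hy => h y (by simp [hy]))).mono le_rfl ?_ ?_
    · push_cast [List.length_cons]; linarith
    · intro y hy
      rcases List.mem_cons.1 hy with rfl | hy
      exacts [.inl rfl, .inr hy]

theorem Computes.add_sub_mul {A : Set 𝓐} {α j n β : 𝓐} (hα : Computes A 1 {α}) (hj : j ∈ A)
    (hn : n ∈ A) (hβ : β ∈ A) : Computes A 4 {α + (j - n) * β} := by
  have h₁ := (Computes.sub hj hn).trans
    (Computes.mul (a := j - n) (b := β) (.inr rfl) (.inl hβ))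
  refine ((hα.union h₁).trans (Computes.add (a := α) (b := (j - n) * β) (.inr (.inl rfl))
    (.inr (.inr rfl)))).mono_cost (by norm_num)

theorem Computes.of_mem_shiftFactors {A : Set 𝓐} {α β : 𝓐} {n : ℕ} (hα : Computes A 1 {α}) (hβ : β ∈ A)
    (hA : ∀ j : ℕ, j ≤ 2 * n + 1 → (j : 𝓐) ∈ A) : ∀ x ∈ shiftFactors α β n, Computes A 4 {x} := by
  intro x hx
  rw [shiftFactors, List.mem_cons, List.mem_append, List.mem_map, List.mem_map] at hx
  rcases hx with rfl | ⟨j, hj, rfl⟩ | ⟨j, hj, rfl⟩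
  · exact Computes.of_subset (by simpa using hβ) (by norm_num)
  · rw [List.mem_range] at hj
    refine Computes.of_subset ?_ (by norm_num)
    have := hA (j + 1) (by omega)
    simpa using this
  · rw [List.mem_range] at hj
    exact Computes.add_sub_mul hα (hA j (by omega)) (hA n (by omega)) hβ

theorem mem_shiftFactors_base (α β : 𝓐) (n : ℕ) : β ∈ shiftFactors α β n := by
  simp [shiftFactors]

theorem mem_shiftFactors_nat (α β : 𝓐) {n j : ℕ} (hj : j < n) :
    (j : 𝓐) + 1 ∈ shiftFactors α β n :=
  List.mem_cons_of_mem _ (List.mem_append_left _ (List.mem_map.2 ⟨j, List.mem_range.2 hj, rfl⟩))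

theorem mem_shiftFactors_arg (α β : 𝓐) {n j : ℕ} (hj : j < 2 * n + 1) :
    α + ((j : 𝓐) - (n : 𝓐)) * β ∈ shiftFactors α β n :=
  List.mem_cons_of_mem _ (List.mem_append_right _ (List.mem_map.2 ⟨j, List.mem_range.2 hj, rfl⟩))

/-- With t = 2^s, the constant 91 is 9 + 40 + 30 + 12: the integers up to 8t, the at most 10t
factors of D(1, t, t) at 4 operations each, their inverses at 3 each, and the Lagrange weights for
all k = 2^i < t. The integers up to 8t later serve as digits in base t (`Computes.natCast`). -/
theorem Computes.exists_shiftData {A : Set 𝓐} (h0 : (0 : 𝓐) ∈ A) (h1 : (1 : 𝓐) ∈ A) {s : ℕ}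
    {δ : 𝓐} (hδA : δ ∈ A) (hδ : δ * bgsD 1 (2 ^ s) (2 ^ s) = 1) :
    ∃ T : Set 𝓐, A ⊆ T ∧ Computes A (91 * 2 ^ s) T ∧ (∀ n : ℕ, n ≤ 8 * 2 ^ s → (n : 𝓐) ∈ T) ∧
      ∀ i < s, Nonempty (ShiftData T ((2 ^ s : ℕ) : 𝓐) (2 ^ i)) := by
  set t := 2 ^ s with ht
  set L := bgsFactors 𝓐 s with hL
  have hδL : δ * L.prod = 1 := by rw [hL, bgsFactors_prod]; exact hδ
  have s₁ := Computes.naturals h0 h1 (8 * t)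
  set A₁ := A ∪ (fun j : ℕ => (j : 𝓐)) '' Set.Iio (8 * t + 1) with hA₁
  have hN : ∀ n : ℕ, n ≤ 8 * t → (n : 𝓐) ∈ A₁ := fun n hn => .inr ⟨n, Nat.lt_succ_of_le hn, rfl⟩
  have hi2 : ∀ i < s, 2 * 2 ^ i ≤ t := fun i hi => by
    rw [ht, ← pow_succ']; exact Nat.pow_le_pow_right (by norm_num) hi
  have hpos : ∀ i, 1 ≤ 2 ^ i := fun i => Nat.one_le_two_pow
  have s₂ : Computes A₁ (L.length * 4) {x | x ∈ L} := by
    refine Computes.list L fun x hx => ?_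
    rw [hL, bgsFactors, List.mem_flatMap] at hx
    obtain ⟨i, hi, hx⟩ := hx
    have h2 := hi2 i (List.mem_range.1 hi)
    have h3 := hpos i
    rcases List.mem_append.1 hx with hx | hx
    · exact Computes.of_mem_shiftFactors (Computes.of_subset (by simpa using hN (2 ^ i) (by omega))
        zero_le_one) (hN _ (by omega)) (fun j hj => hN j (by omega)) x hx
    · refine Computes.of_mem_shiftFactors (Computes.mul ?_ (hN _ (by omega))) (hN _ (by omega))
        (fun j hj => hN j (by omega)) x hx
      have := hN (2 ^ i + 1) (by omega)
      simpa using this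
  set A₂ := A₁ ∪ {x | x ∈ L} with hA₂
  have hAA₁ : A ⊆ A₁ := Set.subset_union_left
  have hAA₂ : A₁ ⊆ A₂ := Set.subset_union_left
  have s₃ := Computes.inverses (A := A₂) (hAA₂ (hAA₁ h1)) L (fun x hx => .inr hx)
    (hAA₂ (hAA₁ hδA)) hδL
  set A₃ := A₂ ∪ {y | ∃ x ∈ L, y * x = 1} with hA₃
  have hAA₃ : A₂ ⊆ A₃ := Set.subset_union_left
  have hinv : ∀ x ∈ L, ∃ y ∈ A₃, y * x = 1 := fun x hx => by
    obtain ⟨y, hy⟩ := exists_mul_eq_one_of_mem hδL hx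
    exact ⟨y, .inr ⟨x, hx, hy⟩, hy⟩
  have hmem₁ : ∀ i < s, ∀ x ∈ shiftFactors ((2 ^ i : ℕ) : 𝓐) (t : 𝓐) (2 ^ i), x ∈ L :=
    fun i hi x hx => List.mem_flatMap.2 ⟨i, List.mem_range.2 hi, List.mem_append_left _ hx⟩
  have hmem₂ : ∀ i < s, ∀ x ∈ shiftFactors ((((2 ^ i : ℕ) : 𝓐) + 1) * (t : 𝓐)) (t : 𝓐) (2 ^ i),
      x ∈ L :=
    fun i hi x hx => List.mem_flatMap.2 ⟨i, List.mem_range.2 hi, List.mem_append_right _ hx⟩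
  have hu : ∀ i, ∃ u : ℕ → 𝓐, i < s → (∀ j < 2 ^ i + 1,
      u j * ∏ l ∈ (Finset.range (2 ^ i + 1)).erase j, ((j : 𝓐) * (t : 𝓐) - (l : 𝓐) * (t : 𝓐)) = 1) ∧
      Computes A₃ (12 * (2 ^ i : ℕ)) (u '' Set.Iio (2 ^ i + 1)) := by
    intro i
    by_cases hi : i < s
    · obtain ⟨τ, hτA, hτ⟩ := hinv _ (hmem₁ i hi _ (mem_shiftFactors_base _ _ _))
      have hy : ∀ j : ℕ, ∃ y : 𝓐, j < 2 ^ i → y ∈ A₃ ∧ y * ((j : 𝓐) + 1) = 1 := fun j => by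
        by_cases hj : j < 2 ^ i
        · obtain ⟨y, h, h'⟩ := hinv _ (hmem₁ i hi _ (mem_shiftFactors_nat _ _ hj))
          exact ⟨y, fun _ => ⟨h, h'⟩⟩
        · exact ⟨0, fun h => absurd h hj⟩
      choose y hy using hy
      obtain ⟨u, h, h'⟩ := Computes.lagrangeWeights (hAA₃ (hAA₂ (hAA₁ h0)))
        (hAA₃ (hAA₂ (hAA₁ h1))) (hpos i) hτA hτ (fun j hj => (hy j hj).1) (fun j hj => (hy j hj).2)
      exact ⟨u, fun _ => ⟨h, h'⟩⟩
    · exact ⟨0, fun h => absurd h hi⟩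
  choose u hu using hu
  have s₄ := Computes.biUnion (A := A₃) (Finset.range s) (f := fun i => 12 * ((2 ^ i : ℕ) : ℝ))
    (B := fun i => u i '' Set.Iio (2 ^ i + 1)) (fun i hi => (hu i (Finset.mem_range.1 hi)).2)
  have s₅ := ((s₁.trans_union s₂).trans_union (s₃.mono_left (by
    rw [hA₂, hA₁, Set.union_assoc]))).trans_union (s₄.mono_left (A' := A ∪ _) (by
    rw [hA₃, hA₂, hA₁, Set.union_assoc, Set.union_assoc]
    rw [Set.union_assoc]))
  set T := A₃ ∪ ⋃ i ∈ Finset.range s, u i '' Set.Iio (2 ^ i + 1) with hT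
  have hAT : A₃ ⊆ T := Set.subset_union_left
  refine ⟨T, fun x hx => hAT (hAA₃ (hAA₂ (hAA₁ hx))), ?_, fun n hn => hAT (hAA₃ (hAA₂ (hN n hn))),
    fun i hi => ?_⟩
  · refine (s₅.union (Computes.of_subset le_rfl le_rfl)).mono le_rfl ?_ ?_
    · have h₁ : (L.length : ℝ) ≤ 10 * 2 ^ s := by exact_mod_cast bgsFactors_length (𝓐 := 𝓐) s
      have h₂ : ∑ i ∈ Finset.range s, 12 * ((2 ^ i : ℕ) : ℝ) ≤ 12 * 2 ^ s := by
        rw [← Finset.mul_sum]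
        push_cast
        rw [geom_sum_eq (by norm_num)]
        have : (0 : ℝ) < 2 ^ s := by positivity
        linarith
      have h₃ : (1 : ℝ) ≤ 2 ^ s := one_le_pow₀ (by norm_num)
      have h₄ : (t : ℝ) = 2 ^ s := by rw [ht]; push_cast; rfl
      rw [Nat.cast_mul, h₄]
      push_cast at h₂ ⊢
      linarith
    · rw [hT, hA₃, hA₂, hA₁]
      rintro x ((((h | h) | h) | h) | h)
      · exact .inr h
      · exact .inl (.inl (.inl (.inl h)))
      · exact .inl (.inl (.inl (.inr h)))
      · exact .inl (.inl (.inr h))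
      · exact .inl (.inr h)
  · have hw₁ : ∀ e : ℕ, ∃ y : 𝓐, e < 2 * 2 ^ i + 1 → y ∈ A₃ ∧
        y * (((2 ^ i : ℕ) : 𝓐) + ((e : 𝓐) - ((2 ^ i : ℕ) : 𝓐)) * (t : 𝓐)) = 1 := fun e => by
      by_cases he : e < 2 * 2 ^ i + 1
      · obtain ⟨y, h, h'⟩ := hinv _ (hmem₁ i hi _ (mem_shiftFactors_arg _ _ he))
        exact ⟨y, fun _ => ⟨h, h'⟩⟩
      · exact ⟨0, fun h => absurd h he⟩
    have hw₂ : ∀ e : ℕ, ∃ y : 𝓐, e < 2 * 2 ^ i + 1 → y ∈ A₃ ∧ y * ((((2 ^ i : ℕ) : 𝓐) + 1) * (t : 𝓐) +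
        ((e : 𝓐) - ((2 ^ i : ℕ) : 𝓐)) * (t : 𝓐)) = 1 := fun e => by
      by_cases he : e < 2 * 2 ^ i + 1
      · obtain ⟨y, h, h'⟩ := hinv _ (hmem₂ i hi _ (mem_shiftFactors_arg _ _ he))
        exact ⟨y, fun _ => ⟨h, h'⟩⟩
      · exact ⟨0, fun h => absurd h he⟩
    choose near hnear using hw₁
    choose far hfar using hw₂
    exact ⟨{
      u := u i
      near := near
      far := far
      u_mul := (hu i hi).1
      near_mul := fun e he => (hnear e he).2
      far_mul := fun e he => (hfar e he).2
      u_mem := fun j hj => .inr (Set.mem_biUnion (x := i) (by simpa using hi) ⟨j, hj, rfl⟩)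
      near_mem := fun e he => hAT (hnear e he).1
      far_mem := fun e he => hAT (hfar e he).1
      near_arg_mem := fun e he =>
        hAT (hAA₃ (.inr (hmem₁ i hi _ (mem_shiftFactors_arg _ _ he))))
      far_arg_mem := fun e he =>
        hAT (hAA₃ (.inr (hmem₂ i hi _ (mem_shiftFactors_arg _ _ he)))) }⟩

end Preparation

/-! ### Products of consecutive values of an affine matrix -/

section BlockProducts

variable {𝓐 : Type u} [CommRing 𝓐] {m : ℕ}

/-- The product `N(x + k) ⋯ N(x + 2) N(x + 1)` for `N(X) = U₀ + X U₁`. -/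
def blockProd (U₀ U₁ : Matrix (Fin m) (Fin m) 𝓐) : ℕ → 𝓐 → Matrix (Fin m) (Fin m) 𝓐
  | 0, _ => 1
  | k + 1, x => (U₀ + (x + ((k + 1 : ℕ) : 𝓐)) • U₁) * blockProd U₀ U₁ k x

variable (U₀ U₁ : Matrix (Fin m) (Fin m) 𝓐)

theorem blockProd_add (k l : ℕ) (x : 𝓐) :
    blockProd U₀ U₁ (k + l) x = blockProd U₀ U₁ l (x + (k : 𝓐)) * blockProd U₀ U₁ k x := by
  induction l with
  | zero => simp [blockProd]
  | succ l ih =>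
    rw [← add_assoc, blockProd, ih, blockProd, Matrix.mul_assoc]
    congr 3
    push_cast; ring

theorem blockProd_one (x : 𝓐) : blockProd U₀ U₁ 1 x = U₀ + (x + 1) • U₁ := by
  simp [blockProd]

/-- Each of the k factors is affine in x; the degree bound is what lets k + 1 grid values determine
the entry. -/
theorem exists_poly_blockProd (k : ℕ) : ∀ a b, ∃ p : 𝓐[X], p.natDegree ≤ k ∧
    ∀ x, p.eval x = blockProd U₀ U₁ k x a b := by
  induction k with
  | zero => exact fun a b => ⟨C ((1 : Matrix (Fin m) (Fin m) 𝓐) a b), by simp, by simp [blockProd]⟩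
  | succ k ih =>
    intro a b
    choose p hp hp' using ih
    refine ⟨∑ c, (C (U₀ a c) + C (U₁ a c) * (X + C ((k + 1 : ℕ) : 𝓐))) * p c b, ?_, fun x => ?_⟩
    · refine natDegree_sum_le_of_forall_le _ _ fun c _ => ?_
      refine natDegree_mul_le.trans ?_
      have h₁ : (C (U₀ a c) + C (U₁ a c) * (X + C ((k + 1 : ℕ) : 𝓐))).natDegree ≤ 1 := by
        refine (natDegree_add_le _ _).trans (max_le (by simp) ?_)
        refine (natDegree_C_mul_le _ _).trans ((natDegree_add_le _ _).trans
          (max_le natDegree_X_le ((natDegree_C _).le.trans zero_le_one)))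
      have := hp c b
      omega
    · rw [eval_finsetSum, blockProd, Matrix.mul_apply]
      refine Finset.sum_congr rfl fun c _ => ?_
      rw [eval_mul, hp']
      simp [Matrix.add_apply]
      ring

/-- The entries of the products of length `k` at `0, β, …, kβ`. -/
def gridSet (β : 𝓐) (k : ℕ) : Set 𝓐 :=
  ⋃ j ∈ Set.Iio (k + 1), entrySet (blockProd U₀ U₁ k ((j : 𝓐) * β))

variable {U₀ U₁}

theorem mem_gridSet {β : 𝓐} {k j : ℕ} (hj : j < k + 1) (a b : Fin m) :
    blockProd U₀ U₁ k ((j : 𝓐) * β) a b ∈ gridSet U₀ U₁ β k :=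
  Set.mem_biUnion (show j ∈ Set.Iio (k + 1) from hj) (mem_entrySet _ a b)

/-- P_{2k}(jβ) = P_k(jβ + k) P_k(jβ) for j ≤ 2k. The values P_k(jβ) with j > k come from a shift by
(k+1)β, the values P_k(jβ + k) from a shift by k followed by one by (k+1)β. These three shifts, at
15μk per entry, give the 45. -/
theorem Computes.gridSet_double {Z T : Set 𝓐} {μ ν : ℝ} {D : ℕ} (hM : PolyMulBound Z μ D)
    (hμ : 1 ≤ μ) (hMM : MatMulBound m Z ν) (hZT : Z ⊆ T) (h0 : (0 : 𝓐) ∈ T) (h1 : (1 : 𝓐) ∈ T)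
    {k : ℕ} (hk : 1 ≤ k) (hkD : 2 * k ≤ D) {β : 𝓐} (S : ShiftData T β k)
    (hT : gridSet U₀ U₁ β k ⊆ T) :
    Computes T (m ^ 2 * (45 * μ * k) + (2 * k + 1) * ν) (gridSet U₀ U₁ β (2 * k)) := by
  choose p hp hpe using exists_poly_blockProd U₀ U₁ k
  set V : Fin m → Fin m → Set 𝓐 := fun a b =>
    ((fun j : ℕ => (p a b).eval ((((k : 𝓐) + 1) * β) + (j : 𝓐) * β)) '' Set.Iio (k + 1)) ∪
    (((fun j : ℕ => (p a b).eval ((k : 𝓐) + (j : 𝓐) * β)) '' Set.Iio (k + 1)) ∪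
    ((fun j : ℕ => ((p a b).comp (X + C (k : 𝓐))).eval ((((k : 𝓐) + 1) * β) + (j : 𝓐) * β)) ''
      Set.Iio (k + 1))) with hV
  have h₁ : ∀ a b, Computes T (45 * μ * k) (V a b) := by
    intro a b
    have hpT : ∀ j < k + 1, (p a b).eval ((j : 𝓐) * β) ∈ T := fun j hj => by
      rw [hpe]; exact hT (mem_gridSet hj a b)
    have s₁ := Computes.shift hM hμ hZT h0 h1 hk hkD S.u_mul S.far_mul S.u_mem S.far_mem
      S.far_arg_mem (hp a b) hpT
    have s₂ := Computes.shift hM hμ hZT h0 h1 hk hkD S.u_mul S.near_mul S.u_mem S.near_mem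
      S.near_arg_mem (hp a b) hpT
    have hq : ((p a b).comp (X + C (k : 𝓐))).natDegree ≤ k := by
      refine natDegree_comp_le.trans ?_
      calc _ ≤ (p a b).natDegree * 1 := Nat.mul_le_mul_left _
            ((natDegree_add_le _ _).trans (max_le natDegree_X_le (by simp)))
        _ ≤ k := by simpa using hp a b
    set T' := T ∪ (fun j : ℕ => (p a b).eval ((k : 𝓐) + (j : 𝓐) * β)) '' Set.Iio (k + 1)
    have hT' : T ⊆ T' := Set.subset_union_left
    have s₃ := Computes.shift (A := T') hM hμ (hZT.trans hT') (hT' h0) (hT' h1) hk hkD S.u_mul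
      S.far_mul (fun j hj => hT' (S.u_mem j hj)) (fun j hj => hT' (S.far_mem j hj))
      (fun j hj => hT' (S.far_arg_mem j hj)) hq (fun j hj => .inr ⟨j, hj, by simp [add_comm]⟩)
    refine (s₁.union (s₂.trans_union s₃)).mono_cost (by linarith)
  have h₂ := Computes.iUnion (κ := Fin m × Fin m) fun q => h₁ q.1 q.2
  have h₃ := h₂.trans (Computes.iUnion_lt (2 * k + 1) (c := ν)
    (B := fun j => entrySet (blockProd U₀ U₁ (2 * k) ((j : 𝓐) * β))) fun j hj => ?_)
  · refine h₃.mono le_rfl ?_ le_rfl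
    simp [sq]
  · rw [two_mul, blockProd_add]
    refine hMM _ (hZT.trans Set.subset_union_left) _ _ ?_ ?_
    · rintro _ ⟨⟨a, b⟩, rfl⟩
      refine .inr (Set.mem_iUnion.2 ⟨(a, b), ?_⟩)
      by_cases h : j < k + 1
      · refine .inr (.inl ⟨j, h, ?_⟩)
        simp only [hpe]
        rw [add_comm]
      · refine .inr (.inr ⟨j - (k + 1), by rw [Set.mem_Iio]; omega, ?_⟩)
        simp only [eval_comp, eval_add, eval_X, eval_C, hpe]
        rw [Nat.cast_sub (by omega)]
        push_cast
        congr 1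
        ring
    · rintro _ ⟨⟨a, b⟩, rfl⟩
      by_cases h : j < k + 1
      · exact .inl (hT (mem_gridSet h a b))
      · refine .inr (Set.mem_iUnion.2 ⟨(a, b), .inl ⟨j - (k + 1), by rw [Set.mem_Iio]; omega, ?_⟩⟩)
        simp only [hpe]
        rw [Nat.cast_sub (by omega)]
        push_cast
        congr 1
        ring

theorem Computes.entrySet_affine {A : Set 𝓐} {x : 𝓐} (hx : x ∈ A) (h₀ : entrySet U₀ ⊆ A)
    (h₁ : entrySet U₁ ⊆ A) : Computes A (m ^ 2 * 2) (entrySet (U₀ + x • U₁)) := by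
  refine Computes.entrySet_of fun a b => ?_
  rw [Matrix.add_apply, Matrix.smul_apply, smul_eq_mul]
  exact ((Computes.mul hx (h₁ (mem_entrySet _ a b))).trans
    (Computes.add (.inl (h₀ (mem_entrySet _ a b))) (.inr rfl))).mono_cost (by norm_num)

theorem ShiftData.mono {T T' : Set 𝓐} {β : 𝓐} {k : ℕ} (S : ShiftData T β k) (h : T ⊆ T') :
    Nonempty (ShiftData T' β k) :=
  ⟨{ S with
    u_mem := fun j hj => h (S.u_mem j hj)
    near_mem := fun j hj => h (S.near_mem j hj)
    far_mem := fun j hj => h (S.far_mem j hj)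
    near_arg_mem := fun j hj => h (S.near_arg_mem j hj)
    far_arg_mem := fun j hj => h (S.far_arg_mem j hj) }⟩

/-- All products of length `2 ^ i` at `0, 2 ^ s, …, 2 ^ i 2 ^ s`, for `i ≤ s`. -/
theorem Computes.gridSets {Z T : Set 𝓐} {μ ν : ℝ} {D : ℕ} (hM : PolyMulBound Z μ D)
    (hμ : 1 ≤ μ) (hMM : MatMulBound m Z ν) (hZT : Z ⊆ T) (h0 : (0 : 𝓐) ∈ T) (h1 : (1 : 𝓐) ∈ T)
    {s : ℕ} (hsD : 2 ^ s ≤ D) (hN : ∀ n : ℕ, n ≤ 8 * 2 ^ s → (n : 𝓐) ∈ T)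
    (hS : ∀ i < s, Nonempty (ShiftData T ((2 ^ s : ℕ) : 𝓐) (2 ^ i)))
    (h₀ : entrySet U₀ ⊆ T) (h₁ : entrySet U₁ ⊆ T) (hν : 0 ≤ ν) :
    Computes T (m ^ 2 * (49 * μ * 2 ^ s) + 3 * 2 ^ s * ν)
      (⋃ i ∈ Set.Iio (s + 1), gridSet U₀ U₁ ((2 ^ s : ℕ) : 𝓐) (2 ^ i)) := by
  have hm : (0 : ℝ) ≤ (m : ℝ) ^ 2 := by positivity
  -- The step from n to n + 1 costs 45μ2^n per entry and 2·2^n + 1 ≤ 3·2^n matrix products, exactly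
  -- what the doubling of the bound allows; the 4 pays for the two affine matrices of level 0.
  have key : ∀ n ≤ s, Computes T (m ^ 2 * ((45 * 2 ^ n + 4) * μ) + 3 * 2 ^ n * ν)
      (⋃ i ∈ Set.Iio (n + 1), gridSet U₀ U₁ ((2 ^ s : ℕ) : 𝓐) (2 ^ i)) := by
    intro n hn
    induction n with
    | zero =>
      have : Computes T ((2 : ℕ) * (m ^ 2 * 2))
          (gridSet U₀ U₁ ((2 ^ s : ℕ) : 𝓐) 1) := by
        refine Computes.iUnion_lt 2 fun j hj => ?_
        rw [blockProd_one]
        refine Computes.entrySet_affine ?_ h₀ h₁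
        have : j * 2 ^ s + 1 ≤ 8 * 2 ^ s := by
          have : 1 ≤ 2 ^ s := Nat.one_le_two_pow
          nlinarith
        have := hN _ this
        push_cast at this ⊢
        exact this
      refine this.mono le_rfl ?_ ?_
      · push_cast; nlinarith [mul_le_mul_of_nonneg_left hμ hm]
      · refine Set.iUnion₂_subset fun i hi => ?_
        rw [zero_add, Set.mem_Iio, Nat.lt_one_iff] at hi
        rw [hi, pow_zero]
    | succ n ih =>
      have h2 : 2 * 2 ^ n ≤ 2 ^ s := by
        rw [← pow_succ']; exact Nat.pow_le_pow_right (by norm_num) hn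
      have ih := ih (by omega)
      obtain ⟨S'⟩ := hS n (by omega)
      have hsub := Set.subset_union_left (s := T)
        (t := ⋃ i ∈ Set.Iio (n + 1), gridSet U₀ U₁ ((2 ^ s : ℕ) : 𝓐) (2 ^ i))
      obtain ⟨S⟩ := S'.mono hsub
      have := ih.trans_union (Computes.gridSet_double (U₀ := U₀) (U₁ := U₁) (β := ((2 ^ s : ℕ) : 𝓐))
        hM hμ hMM (hZT.trans hsub) (hsub h0) (hsub h1) Nat.one_le_two_pow (h2.trans hsD) S
        ((Set.subset_biUnion_of_mem (u := fun i => gridSet U₀ U₁ ((2 ^ s : ℕ) : 𝓐) (2 ^ i))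
          (show n ∈ Set.Iio (n + 1) by simp)).trans Set.subset_union_right))
      refine this.mono le_rfl ?_ ?_
      · have h2n : (1 : ℝ) ≤ 2 ^ n := one_le_pow₀ (by norm_num)
        rw [pow_succ (2 : ℝ) n]
        push_cast
        nlinarith [mul_nonneg hν (sub_nonneg.2 h2n)]
      · refine Set.iUnion₂_subset fun i hi => ?_
        rcases Nat.lt_succ_iff_lt_or_eq.1 (show i < n + 1 + 1 from hi) with h | rfl
        · exact (Set.subset_biUnion_of_mem
            (u := fun i => gridSet U₀ U₁ ((2 ^ s : ℕ) : 𝓐) (2 ^ i))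
            (show i ∈ Set.Iio (n + 1) from h)).trans Set.subset_union_left
        · rw [pow_succ']
          exact Set.subset_union_right
  refine (key s le_rfl).mono_cost ?_
  have h2n : (1 : ℝ) ≤ 2 ^ s := one_le_pow₀ (by norm_num)
  have : (45 * 2 ^ s + 4) * μ ≤ 49 * μ * 2 ^ s := by
    nlinarith [mul_nonneg (by linarith : 0 ≤ μ) (sub_nonneg.2 h2n)]
  nlinarith [mul_le_mul_of_nonneg_left this hm]

end BlockProducts

/-! ### Evaluation of a polynomial at many points -/

section Multipoint

variable {𝓐 : Type u} [CommRing 𝓐]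

/-- The subproduct tree: `subprod i x = ∏ l < 2 ^ i, (1 - x l X)`. -/
noncomputable def subprod : ℕ → (ℕ → 𝓐) → 𝓐[X]
  | 0, x => 1 - C (x 0) * X
  | i + 1, x => subprod i x * subprod i fun l => x (2 ^ i + l)

theorem subprod_eq_prod (i : ℕ) (x : ℕ → 𝓐) :
    subprod i x = ∏ l ∈ Finset.range (2 ^ i), (1 - C (x l) * X) := by
  induction i generalizing x with
  | zero => simp [subprod]
  | succ i ih => rw [subprod, ih, ih, pow_succ, mul_two, Finset.prod_range_add]

theorem natDegree_one_sub_C_mul_X_le (a : 𝓐) : (1 - C a * X).natDegree ≤ 1 :=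
  (natDegree_sub_le _ _).trans (max_le (by simp)
    ((natDegree_C_mul_le _ _).trans natDegree_X_le))

theorem natDegree_prod_one_sub_le (s : Finset ℕ) (x : ℕ → 𝓐) :
    (∏ l ∈ s, (1 - C (x l) * X)).natDegree ≤ s.card := by
  refine (natDegree_prod_le _ _).trans ?_
  refine (Finset.sum_le_card_nsmul _ _ 1 fun l _ => natDegree_one_sub_C_mul_X_le _).trans ?_
  simp

theorem natDegree_subprod_le (i : ℕ) (x : ℕ → 𝓐) : (subprod i x).natDegree ≤ 2 ^ i := by
  rw [subprod_eq_prod]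
  simpa using natDegree_prod_one_sub_le (Finset.range (2 ^ i)) x

theorem subprod_coeff_zero (i : ℕ) (x : ℕ → 𝓐) : (subprod i x).coeff 0 = 1 := by
  rw [subprod_eq_prod, coeff_zero_eq_eval_zero, eval_prod]
  simp

/-- The coefficients of all nodes of the subproduct tree. -/
def treeSet : ℕ → (ℕ → 𝓐) → Set 𝓐
  | 0, x => coeffSet (subprod 0 x)
  | i + 1, x => coeffSet (subprod (i + 1) x) ∪ (treeSet i x ∪ treeSet i fun l => x (2 ^ i + l))

theorem coeffSet_subprod_subset (i : ℕ) (x : ℕ → 𝓐) : coeffSet (subprod i x) ⊆ treeSet i x := by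
  cases i with
  | zero => exact le_rfl
  | succ i => exact Set.subset_union_left

theorem Computes.subproductTree {Z : Set 𝓐} {μ : ℝ} {D : ℕ} (hM : PolyMulBound Z μ D)
    (hμ : 1 ≤ μ) (i : ℕ) : ∀ {A : Set 𝓐} (_ : Z ⊆ A) (_ : (0 : 𝓐) ∈ A) (_ : (1 : 𝓐) ∈ A)
    (_ : 2 ^ i ≤ D) (x : ℕ → 𝓐) (_ : ∀ l < 2 ^ i, x l ∈ A),
    Computes A ((i + 1) * 2 ^ i * μ) (treeSet i x) := by
  induction i with
  | zero =>
    intro A hZA h0 h1 _ x hx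
    refine ((Computes.sub h0 (hx 0 (by simp))).union
      (Computes.of_subset (B := {0, 1}) ?_ le_rfl)).mono le_rfl ?_ ?_
    · rintro y (rfl | rfl) <;> assumption
    · simpa using hμ
    · rintro _ ⟨l, rfl⟩
      rcases l with _ | _ | l
      · right; simp [subprod]
      · left; simp [subprod, coeff_one]
      · right; simp [subprod, coeff_one]
  | succ i ih =>
    intro A hZA h0 h1 hD x hx
    have h2 : (2 : ℕ) ^ (i + 1) = 2 ^ i + 2 ^ i := by ring
    have s₁ := (ih hZA h0 h1 (by omega) x fun l hl => hx l (by omega)).union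
      (ih hZA h0 h1 (by omega) (fun l => x (2 ^ i + l)) fun l hl => hx _ (by omega))
    have s₂ := s₁.trans_union (hM _ (hZA.trans Set.subset_union_left) (2 ^ i) Nat.one_le_two_pow
      (by omega) (subprod i x) (subprod i fun l => x (2 ^ i + l)) (natDegree_subprod_le _ _)
      (natDegree_subprod_le _ _)
      ((coeffSet_subprod_subset _ _).trans (Set.subset_union_left.trans Set.subset_union_right))
      ((coeffSet_subprod_subset _ _).trans (Set.subset_union_right.trans Set.subset_union_right)))
    refine s₂.mono le_rfl ?_ ?_
    · have : (0 : ℝ) ≤ 2 ^ i * μ := by positivity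
      rw [pow_succ (2 : ℝ) i]
      push_cast
      nlinarith
    · rw [treeSet, Set.union_comm]
      rfl

/-- The numerators of the partial fractions `∑ l < 2 ^ i, c l / (1 - y l X)`. -/
noncomputable def combo : ℕ → (ℕ → 𝓐) → (ℕ → 𝓐) → 𝓐[X]
  | 0, _, c => C (c 0)
  | i + 1, y, c => combo i y c * subprod i (fun l => y (2 ^ i + l)) +
      combo i (fun l => y (2 ^ i + l)) (fun l => c (2 ^ i + l)) * subprod i y

theorem natDegree_combo_le (i : ℕ) : ∀ (y c : ℕ → 𝓐), (combo i y c).natDegree ≤ 2 ^ i := by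
  induction i with
  | zero => intro y c; simp [combo]
  | succ i ih =>
    intro y c
    have h2 : (2 : ℕ) ^ (i + 1) = 2 ^ i + 2 ^ i := by ring
    rw [h2]
    refine (natDegree_add_le _ _).trans (max_le ?_ ?_)
    · exact natDegree_mul_le.trans (add_le_add (ih _ _) (natDegree_subprod_le _ _))
    · exact natDegree_mul_le.trans (add_le_add (ih _ _) (natDegree_subprod_le _ _))

/-- The omitted factor is replaced by 1 instead of being erased, so that the product splits into
halves: the half containing j is handled by induction, the other is a subproduct. -/
theorem combo_eq_sum (i : ℕ) : ∀ (y c : ℕ → 𝓐), combo i y c =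
    ∑ j ∈ Finset.range (2 ^ i), C (c j) *
      ∏ l ∈ Finset.range (2 ^ i), if l = j then 1 else (1 - C (y l) * X) := by
  induction i with
  | zero => intro y c; simp [combo]
  | succ i ih =>
    intro y c
    rw [combo, ih, ih, pow_succ, mul_two, Finset.sum_range_add, Finset.sum_mul, Finset.sum_mul]
    refine congrArg₂ (· + ·) ?_ ?_
    · refine Finset.sum_congr rfl fun j hj => ?_
      rw [Finset.mem_range] at hj
      rw [Finset.prod_range_add, mul_assoc, subprod_eq_prod]
      refine congrArg (C (c j) * ·) (congrArg₂ (· * ·) rfl ?_)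
      refine Finset.prod_congr rfl fun l _ => ?_
      rw [if_neg (by omega)]
    · refine Finset.sum_congr rfl fun j hj => ?_
      rw [Finset.prod_range_add, mul_assoc, subprod_eq_prod, mul_comm (∏ l ∈ _, _) (∏ l ∈ _, _)]
      refine congrArg (C (c (2 ^ i + j)) * ·) (congrArg₂ (· * ·) ?_ ?_)
      · refine Finset.prod_congr rfl fun l hl => ?_
        rw [Finset.mem_range] at hl
        rw [if_neg (by omega)]
      · refine Finset.prod_congr rfl fun l _ => ?_
        simp only [Nat.add_left_cancel_iff]

theorem Computes.coeffSet_combo {Z : Set 𝓐} {μ : ℝ} {D : ℕ} (hM : PolyMulBound Z μ D)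
    (hμ : 1 ≤ μ) (i : ℕ) : ∀ {A : Set 𝓐} (_ : Z ⊆ A) (_ : (0 : 𝓐) ∈ A)
    (_ : 2 ^ i ≤ 2 * D) (y c : ℕ → 𝓐) (_ : treeSet i y ⊆ A) (_ : ∀ l < 2 ^ i, c l ∈ A),
    Computes A (3 * i * 2 ^ i * μ) (coeffSet (combo i y c)) := by
  induction i with
  | zero =>
    intro A hZA h0 _ y c _ hc
    refine Computes.of_subset ?_ (by simp)
    rintro _ ⟨l, rfl⟩
    rw [combo, coeff_C]
    split_ifs
    exacts [hc 0 (by simp), h0]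
  | succ i ih =>
    intro A hZA h0 hD y c hy hc
    have h2 : (2 : ℕ) ^ (i + 1) = 2 ^ i + 2 ^ i := by ring
    have hy₁ : treeSet i y ⊆ A :=
      (Set.subset_union_left.trans Set.subset_union_right).trans hy
    have hy₂ : treeSet i (fun l => y (2 ^ i + l)) ⊆ A :=
      (Set.subset_union_right.trans Set.subset_union_right).trans hy
    have hmul : ∀ y' c' z : ℕ → 𝓐, treeSet i y' ⊆ A → treeSet i z ⊆ A →
        (∀ l < 2 ^ i, c' l ∈ A) →
        Computes A (3 * i * 2 ^ i * μ + μ * (2 ^ i : ℕ))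
          (coeffSet (combo i y' c' * subprod i z)) := by
      intro y' c' z h₁ h₂ h₃
      exact (ih hZA h0 (by omega) y' c' h₁ h₃).trans (hM _ (hZA.trans Set.subset_union_left) (2 ^ i)
        Nat.one_le_two_pow (by omega) _ _ (natDegree_combo_le _ _ _) (natDegree_subprod_le _ _)
        Set.subset_union_right
        ((coeffSet_subprod_subset _ _).trans (h₂.trans Set.subset_union_left)))
    have s₁ := hmul y c (fun l => y (2 ^ i + l)) hy₁ hy₂ fun l hl => hc l (by omega)
    have s₂ := hmul (fun l => y (2 ^ i + l)) (fun l => c (2 ^ i + l)) y hy₂ hy₁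
      fun l hl => hc _ (by omega)
    have hdeg : ∀ y' c' z : ℕ → 𝓐, (combo i y' c' * subprod i z).natDegree ≤ 2 ^ i + 2 ^ i :=
      fun y' c' z => natDegree_mul_le.trans
        (add_le_add (natDegree_combo_le _ _ _) (natDegree_subprod_le _ _))
    have s₃ := (s₁.union s₂).trans (Computes.coeffSet_add (.inl h0) (hdeg _ _ _) (hdeg _ _ _)
      (Set.subset_union_left.trans Set.subset_union_right)
      (Set.subset_union_right.trans Set.subset_union_right))
    refine s₃.mono le_rfl ?_ le_rfl
    have : (1 : ℝ) ≤ 2 ^ i := one_le_pow₀ (by norm_num)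
    rw [pow_succ (2 : ℝ) i]
    push_cast
    nlinarith [mul_le_mul_of_nonneg_left hμ (by positivity : (0 : ℝ) ≤ 2 ^ i)]

/-! #### Generating functions -/

/-- The power series `1 / (1 - x X)`. -/
noncomputable def geo (x : 𝓐) : PowerSeries 𝓐 := PowerSeries.mk fun n => x ^ n

theorem one_sub_mul_geo (x : 𝓐) :
    ((1 - C x * X : 𝓐[X]) : PowerSeries 𝓐) * geo x = 1 := by
  ext n
  rw [Polynomial.coe_sub, Polynomial.coe_mul, Polynomial.coe_one, Polynomial.coe_C,
    Polynomial.coe_X, sub_mul, one_mul, mul_assoc, map_sub, PowerSeries.coeff_C_mul]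
  cases n with
  | zero => simp [geo]
  | succ n => simp [geo, PowerSeries.coeff_succ_X_mul, PowerSeries.coeff_one, pow_succ']

/-- Multiplication by 1 - xX turns p · `geo x` into p, whose coefficient of index n + 1 vanishes. -/
theorem coeff_succ_mul_geo {p : 𝓐[X]} {n : ℕ} (hp : p.natDegree ≤ n) (x : 𝓐) :
    PowerSeries.coeff (n + 1) ((p : PowerSeries 𝓐) * geo x) =
      x * PowerSeries.coeff n ((p : PowerSeries 𝓐) * geo x) := by
  have h := congrArg (fun g => PowerSeries.coeff (n + 1) ((p : PowerSeries 𝓐) * g))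
    (one_sub_mul_geo x)
  simp only [mul_one, Polynomial.coeff_coe] at h
  rw [coeff_eq_zero_of_natDegree_lt (by omega), Polynomial.coe_sub, Polynomial.coe_mul,
    Polynomial.coe_one, Polynomial.coe_C, Polynomial.coe_X] at h
  have h' : (p : PowerSeries 𝓐) * ((1 - PowerSeries.C x * PowerSeries.X) * geo x) =
      (p : PowerSeries 𝓐) * geo x -
        PowerSeries.C x * (PowerSeries.X * ((p : PowerSeries 𝓐) * geo x)) := by ring
  rw [h', map_sub, PowerSeries.coeff_C_mul, PowerSeries.coeff_succ_X_mul] at h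
  exact sub_eq_zero.1 h

/-- For deg p ≤ n, the coefficient of index n in p · `geo x` is the value at x of the reversed
polynomial X^n p(1/X), and the reverse of 1 - yX is X - y. Evaluation thus becomes extraction of a
coefficient, with no division with remainder. -/
theorem coeff_prod_mul_geo (s : Finset ℕ) (y : ℕ → 𝓐) (x : 𝓐) :
    PowerSeries.coeff s.card
      (((∏ l ∈ s, (1 - C (y l) * X) : 𝓐[X]) : PowerSeries 𝓐) * geo x) =
      ∏ l ∈ s, (x - y l) := by
  induction s using Finset.induction_on with
  | empty => simp [geo]
  | insert a s ha ih =>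
    rw [Finset.prod_insert ha, Finset.prod_insert ha, Finset.card_insert_of_notMem ha, ← ih,
      Polynomial.coe_mul, Polynomial.coe_sub, Polynomial.coe_mul, Polynomial.coe_one,
      Polynomial.coe_C, Polynomial.coe_X, mul_assoc, sub_mul, one_mul, mul_assoc, map_sub,
      PowerSeries.coeff_C_mul, PowerSeries.coeff_succ_X_mul,
      coeff_succ_mul_geo (natDegree_prod_one_sub_le s y)]
    ring

/-- The interpolation polynomial in reversed form. -/
theorem coeff_sum_mul_geo (k : ℕ) (y c : ℕ → 𝓐) (x : 𝓐) :
    PowerSeries.coeff k (((∑ j ∈ Finset.range (k + 1), C (c j) *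
      ∏ l ∈ (Finset.range (k + 1)).erase j, (1 - C (y l) * X) : 𝓐[X]) : PowerSeries 𝓐) * geo x) =
      ∑ j ∈ Finset.range (k + 1), c j * ∏ l ∈ (Finset.range (k + 1)).erase j, (x - y l) := by
  rw [← Polynomial.coeToPowerSeries.ringHom_apply, map_sum, Finset.sum_mul, map_sum]
  refine Finset.sum_congr rfl fun j hj => ?_
  have h := coeff_prod_mul_geo ((Finset.range (k + 1)).erase j) y x
  rw [Finset.card_erase_of_mem hj, Finset.card_range, Nat.add_sub_cancel] at h
  rw [Polynomial.coeToPowerSeries.ringHom_apply, Polynomial.coe_mul, Polynomial.coe_C, mul_assoc,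
    PowerSeries.coeff_C_mul, h]

/-- Padding the nodes and the coefficients by 0 is harmless: the new factors 1 - 0·X are 1 and the
new summands vanish. -/
theorem combo_pad {i k : ℕ} (hk : k + 1 ≤ 2 ^ i) (y c : ℕ → 𝓐) :
    combo i (fun l => if l < k + 1 then y l else 0) (fun l => if l < k + 1 then c l else 0) =
      ∑ j ∈ Finset.range (k + 1), C (c j) *
        ∏ l ∈ (Finset.range (k + 1)).erase j, (1 - C (y l) * X) := by
  rw [combo_eq_sum, ← Finset.sum_subset (Finset.range_mono hk)]
  · refine Finset.sum_congr rfl fun j hj => ?_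
    rw [if_pos (Finset.mem_range.1 hj), ← Finset.prod_subset ((Finset.erase_subset j _).trans
      (Finset.range_mono hk))]
    · congr 1
      refine Finset.prod_congr rfl fun l hl => ?_
      rw [Finset.mem_erase, Finset.mem_range] at hl
      rw [if_neg hl.1, if_pos hl.2]
    · intro l _ hl
      rw [Finset.mem_erase, Finset.mem_range, not_and_or, not_not] at hl
      rcases hl with rfl | hl
      · simp
      · simp [hl]
  · intro j _ hj
    rw [Finset.mem_range] at hj
    simp [hj]

end Multipoint

/-! ### Power series inversion, interpolation and multipoint evaluation -/

section Evaluation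

variable {𝓐 : Type u} [CommRing 𝓐]

theorem X_pow_dvd_sub_seqPoly (N : ℕ) (p : 𝓐[X]) : X ^ N ∣ p - seqPoly N p.coeff := by
  rw [X_pow_dvd_iff]
  intro d hd
  rw [coeff_sub, seqPoly_coeff, if_pos hd, sub_self]

/-- Inversion of a power series by Newton iteration. -/
theorem Computes.newton {Z A : Set 𝓐} {μ : ℝ} {D : ℕ} (hM : PolyMulBound Z μ D) (hμ : 1 ≤ μ)
    (hZA : Z ⊆ A) (h0 : (0 : 𝓐) ∈ A) (h1 : (1 : 𝓐) ∈ A) (h2 : (2 : 𝓐) ∈ A) {n : ℕ} (hn : 1 ≤ n)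
    (hnD : n ≤ D) {Q : 𝓐[X]} (hQ : Q.natDegree ≤ n) (hQ0 : Q.coeff 0 = 1) (hQA : coeffSet Q ⊆ A)
    (r : ℕ) : ∃ B : 𝓐[X], B.natDegree ≤ n ∧ X ^ (min (2 ^ r) (n + 1)) ∣ Q * B - 1 ∧
      Computes A (r * (4 * μ * n)) (coeffSet B) := by
  induction r with
  | zero =>
    refine ⟨1, by simp, ?_, Computes.of_subset ?_ (by simp)⟩
    · rw [pow_zero, min_eq_left (by omega), pow_one, mul_one, X_dvd_iff, coeff_sub, hQ0]
      simp
    · rintro _ ⟨i, rfl⟩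
      rw [coeff_one]
      split_ifs
      exacts [h1, h0]
  | succ r ih =>
    obtain ⟨B, hB, hdvd, hc⟩ := ih
    -- The Newton step is B ↦ B(2 - QB), with 1 - QB(2 - QB) = (1 - QB)²; truncating at X^(n+1)
    -- keeps all degrees at most n.
    set E : 𝓐[X] := C 2 - seqPoly (n + 1) (Q * B).coeff with hE
    have hEdeg : E.natDegree ≤ n := (natDegree_sub_le _ _).trans
      (max_le (by simp) (seqPoly_natDegree_le _ le_rfl))
    refine ⟨seqPoly (n + 1) (B * E).coeff, seqPoly_natDegree_le _ le_rfl, ?_, ?_⟩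
    · have d₁ := X_pow_dvd_sub_seqPoly (n + 1) (B * E)
      have d₂ := X_pow_dvd_sub_seqPoly (n + 1) (Q * B)
      have hle : min (2 ^ (r + 1)) (n + 1) ≤ n + 1 := min_le_right _ _
      have hle' : min (2 ^ (r + 1)) (n + 1) ≤ 2 * min (2 ^ r) (n + 1) := by
        rw [pow_succ]; omega
      have d₃ : X ^ min (2 ^ (r + 1)) (n + 1) ∣ (Q * B - 1) ^ 2 := by
        refine (pow_dvd_pow X hle').trans ?_
        rw [mul_comm 2, pow_mul]
        exact pow_dvd_pow_of_dvd hdvd 2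
      have e : Q * seqPoly (n + 1) (B * E).coeff - 1 =
          -(Q * (B * E - seqPoly (n + 1) (B * E).coeff)) +
          (Q * B) * (Q * B - seqPoly (n + 1) (Q * B).coeff) - (Q * B - 1) ^ 2 := by
        rw [hE]
        simp only [map_ofNat]
        ring
      rw [e]
      have d₁' := (pow_dvd_pow X hle).trans d₁
      have d₂' := (pow_dvd_pow X hle).trans d₂
      exact dvd_sub (dvd_add ((dvd_mul_of_dvd_right d₁' _).neg_right)
        (dvd_mul_of_dvd_right d₂' _)) d₃
    · have s₁ := hc.trans_union (hM (A ∪ coeffSet B) (hZA.trans Set.subset_union_left) n hn hnD Q B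
        hQ hB (hQA.trans Set.subset_union_left) Set.subset_union_right)
      set A₁ := A ∪ (coeffSet B ∪ coeffSet (Q * B)) with hA₁
      have hAA₁ : A ⊆ A₁ := Set.subset_union_left
      have s₂ : Computes A₁ ((n + 1 : ℕ) * 1) (coeffSet E) := by
        refine Computes.coeffSet_of_lt (hAA₁ h0)
          (fun i hi => coeff_eq_zero_of_natDegree_lt (by omega)) fun i hi => ?_
        rw [hE, coeff_sub, seqPoly_coeff, if_pos hi, coeff_C]
        refine Computes.sub ?_ (.inr (.inr (mem_coeffSet _ _)))
        split_ifs
        exacts [hAA₁ h2, hAA₁ h0]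
      have s₃ := s₁.trans (s₂.trans (hM (A₁ ∪ coeffSet E) ((hZA.trans hAA₁).trans
        Set.subset_union_left) n hn hnD B E hB hEdeg
        ((Set.subset_union_left.trans Set.subset_union_right).trans Set.subset_union_left)
        Set.subset_union_right))
      refine (s₃.union (Computes.of_subset (Set.singleton_subset_iff.2 h0) le_rfl)).mono le_rfl
        ?_ ?_
      · have hn' : (1 : ℝ) ≤ n := by exact_mod_cast hn
        push_cast
        nlinarith [mul_le_mul_of_nonneg_right hμ (by linarith : (0 : ℝ) ≤ n)]
      · exact coeffSet_seqPoly_subset (.inr rfl) fun i _ => .inl (mem_coeffSet _ _)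

/-- The coefficient of index o + e in Q · G involves only the coefficients of G with indices from o
+ e - d to o + e, and these lie in the window. -/
theorem coeff_mul_window {Q : 𝓐[X]} {d L o e : ℕ} (hQ : Q.natDegree ≤ d) (hde : d ≤ e) (heL : e < L)
    (G : PowerSeries 𝓐) :
    (Q * seqPoly L fun j => PowerSeries.coeff (o + j) G).coeff e =
      PowerSeries.coeff (o + e) ((Q : PowerSeries 𝓐) * G) := by
  rw [coeff_mul, PowerSeries.coeff_mul, Finset.Nat.sum_antidiagonal_eq_sum_range_succ_mk,
    Finset.Nat.sum_antidiagonal_eq_sum_range_succ_mk,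
    ← Finset.sum_subset (Finset.range_mono (show d + 1 ≤ e.succ by omega)),
    ← Finset.sum_subset (Finset.range_mono (show d + 1 ≤ (o + e).succ by omega))]
  · refine Finset.sum_congr rfl fun j hj => ?_
    rw [Finset.mem_range] at hj
    rw [seqPoly_coeff, if_pos (by omega), Polynomial.coeff_coe, show o + (e - j) = o + e - j by omega]
  · intro j _ hj
    rw [Finset.mem_range] at hj
    rw [Polynomial.coeff_coe, coeff_eq_zero_of_natDegree_lt (by omega), zero_mul]
  · intro j _ hj
    rw [Finset.mem_range] at hj
    rw [coeff_eq_zero_of_natDegree_lt (by omega), zero_mul]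

/-- `geo (x l)` cancels the factor of its own leaf, so the output is the coefficient of index n of G
times the factors of all other leaves. Going down the tree, G is multiplied by the sibling's
subproduct. With half as many factors to come, half as many coefficients below index n + 1 need to
be known. -/
theorem Computes.descent {Z : Set 𝓐} {μ : ℝ} {D : ℕ} (hM : PolyMulBound Z μ D)
    {n : ℕ} (i : ℕ) : ∀ {A : Set 𝓐} (_ : Z ⊆ A) (_ : (0 : 𝓐) ∈ A) (_ : 2 ^ i ≤ D) (_ : 2 ^ i ≤ n)
    (x : ℕ → 𝓐) (_ : treeSet i x ⊆ A) (G : PowerSeries 𝓐)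
    (_ : ∀ j < 2 ^ i, PowerSeries.coeff (n + 1 - 2 ^ i + j) G ∈ A),
    Computes A (2 * i * 2 ^ i * μ) ((fun l => PowerSeries.coeff n
      ((subprod i x : PowerSeries 𝓐) * G * geo (x l))) '' Set.Iio (2 ^ i)) := by
  induction i with
  | zero =>
    intro A _ _ _ hn x _ G hG
    refine Computes.of_subset ?_ (by simp)
    rintro _ ⟨l, hl, rfl⟩
    rw [pow_zero, Set.mem_Iio, Nat.lt_one_iff] at hl
    subst hl
    have h : ((subprod 0 x : 𝓐[X]) : PowerSeries 𝓐) * G * geo (x 0) = G := by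
      rw [mul_right_comm, subprod, one_sub_mul_geo, one_mul]
    have := hG 0 (by simp)
    simp only [h]
    simpa using this
  | succ i ih =>
    intro A hZA h0 hD hn x hx G hG
    have h2 : (2 : ℕ) ^ (i + 1) = 2 ^ i + 2 ^ i := by ring
    have hpos : 1 ≤ 2 ^ i := Nat.one_le_two_pow
    have hx₁ : treeSet i x ⊆ A := (Set.subset_union_left.trans Set.subset_union_right).trans hx
    have hx₂ : treeSet i (fun l => x (2 ^ i + l)) ⊆ A :=
      (Set.subset_union_right.trans Set.subset_union_right).trans hx
    have half : ∀ y z : ℕ → 𝓐, treeSet i y ⊆ A → treeSet i z ⊆ A →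
        Computes A (μ * (2 ^ (i + 1) : ℕ) + 2 * i * 2 ^ i * μ) ((fun l => PowerSeries.coeff n
          ((subprod i y : PowerSeries 𝓐) * ((subprod i z : PowerSeries 𝓐) * G) * geo (y l))) ''
            Set.Iio (2 ^ i)) := by
      intro y z hy hz
      set a := seqPoly (2 ^ (i + 1)) fun j => PowerSeries.coeff (n + 1 - 2 ^ (i + 1) + j) G with ha
      have s₁ := hM A hZA (2 ^ (i + 1)) Nat.one_le_two_pow hD (subprod i z) a
        ((natDegree_subprod_le _ _).trans (by omega)) (seqPoly_natDegree_le _ (by omega))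
        ((coeffSet_subprod_subset _ _).trans hz) (coeffSet_seqPoly_subset h0 hG)
      refine s₁.trans (ih (hZA.trans Set.subset_union_left) (.inl h0) (by omega) (by omega) y
        (hy.trans Set.subset_union_left) _ fun j hj => .inr ?_)
      have := coeff_mul_window (o := n + 1 - 2 ^ (i + 1)) (L := 2 ^ (i + 1)) (e := 2 ^ i + j)
        (natDegree_subprod_le i z) (by omega) (by omega) G
      rw [show n + 1 - 2 ^ (i + 1) + (2 ^ i + j) = n + 1 - 2 ^ i + j by omega] at this
      rw [← this]
      exact mem_coeffSet _ _
    have s₁ := half x (fun l => x (2 ^ i + l)) hx₁ hx₂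
    have s₂ := half (fun l => x (2 ^ i + l)) x hx₂ hx₁
    refine (s₁.union s₂).mono le_rfl ?_ ?_
    · refine le_of_eq ?_
      push_cast; ring
    · rintro _ ⟨l, hl, rfl⟩
      rw [Set.mem_Iio] at hl
      simp only [subprod, Polynomial.coe_mul]
      by_cases h : l < 2 ^ i
      · refine .inl ⟨l, h, ?_⟩
        simp only [mul_assoc]
      · refine .inr ⟨l - 2 ^ i, by rw [Set.mem_Iio]; omega, ?_⟩
        simp only
        rw [show 2 ^ i + (l - 2 ^ i) = l by omega, mul_left_comm]
        simp only [mul_assoc]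

/-- Interpolation: from the values at `0, β, …, kβ` to the (reversed) coefficients. -/
theorem Computes.interpolate {Z A : Set 𝓐} {μ : ℝ} {D : ℕ} (hM : PolyMulBound Z μ D) (hμ : 1 ≤ μ)
    (hZA : Z ⊆ A) (h0 : (0 : 𝓐) ∈ A) (h1 : (1 : 𝓐) ∈ A) {i : ℕ} (hD : 2 ^ (i + 1) ≤ D) {β : 𝓐}
    {u : ℕ → 𝓐} (hu : ∀ j < 2 ^ i + 1, u j * ∏ l ∈ (Finset.range (2 ^ i + 1)).erase j,
      ((j : 𝓐) * β - (l : 𝓐) * β) = 1) (huA : ∀ j < 2 ^ i + 1, u j ∈ A)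
    (hyA : ∀ j : ℕ, j < 2 ^ i + 1 → (j : 𝓐) * β ∈ A)
    {f : 𝓐[X]} (hf : f.natDegree ≤ 2 ^ i) (hfA : ∀ j : ℕ, j < 2 ^ i + 1 → f.eval ((j : 𝓐) * β) ∈ A) :
    ∃ F : 𝓐[X], F.natDegree ≤ 2 ^ i ∧
      (∀ x, PowerSeries.coeff (2 ^ i) ((F : PowerSeries 𝓐) * geo x) = f.eval x) ∧
      Computes A (12 * (i + 1) * 2 ^ i * μ) (coeffSet F) := by
  set k := 2 ^ i with hk
  have hk1 : 1 ≤ k := Nat.one_le_two_pow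
  have hk2 : 2 ^ (i + 1) = 2 * k := by rw [hk]; ring
  set c : ℕ → 𝓐 := fun j => f.eval ((j : 𝓐) * β) * u j with hc
  refine ⟨∑ j ∈ Finset.range (k + 1), C (c j) *
        ∏ l ∈ (Finset.range (k + 1)).erase j, (1 - C ((l : 𝓐) * β) * X), ?_, fun x => ?_, ?_⟩
  · refine natDegree_sum_le_of_forall_le _ _ fun j hj => (natDegree_C_mul_le _ _).trans ?_
    refine (natDegree_prod_one_sub_le _ fun l : ℕ => (l : 𝓐) * β).trans ?_
    rw [Finset.card_erase_of_mem hj]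
    simp
  · rw [coeff_sum_mul_geo k (fun l => (l : 𝓐) * β) c x,
      eval_eq_sum_lagrange (y := fun j => (j : 𝓐) * β) hu (Nat.lt_succ_of_le hf)]
  -- The 2^i + 1 nodes do not fit into a tree of depth i, so one more level is used.
  · rw [← combo_pad (i := i + 1) (by omega) (fun l => (l : 𝓐) * β) c]
    have s₁ : Computes A ((k + 1 : ℕ) * 1) (c '' Set.Iio (k + 1)) :=
      Computes.image_lt (k + 1) fun j hj => Computes.mul (hfA j hj) (huA j hj)
    have s₂ := Computes.subproductTree hM hμ (i + 1) hZA h0 h1 hD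
      (fun l : ℕ => if l < k + 1 then (l : 𝓐) * β else 0) (fun l _ => by
        split_ifs with h
        exacts [hyA l h, h0])
    refine ((s₁.union s₂).trans (Computes.coeffSet_combo hM hμ (i + 1)
      (hZA.trans Set.subset_union_left) (.inl h0) (by omega) _ _
      (Set.subset_union_right.trans Set.subset_union_right) fun l _ => ?_)).mono_cost ?_
    · split_ifs with h
      · exact .inr (.inl ⟨l, h, rfl⟩)
      · exact .inl h0
    · have hk' : (1 : ℝ) ≤ 2 ^ i := one_le_pow₀ (by norm_num)
      have h' : (2 : ℝ) ^ i ≤ 2 ^ i * μ := le_mul_of_one_le_right (by linarith) hμ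
      have hi' : (0 : ℝ) ≤ i * (2 ^ i * μ) := by positivity
      rw [pow_succ (2 : ℝ) i, hk]
      push_cast
      nlinarith

/-- Evaluation at `2 ^ J` points. -/
theorem Computes.evaluate {Z A : Set 𝓐} {μ : ℝ} {D : ℕ} (hM : PolyMulBound Z μ D) (hμ : 1 ≤ μ)
    (hZA : Z ⊆ A) (h0 : (0 : 𝓐) ∈ A) (h1 : (1 : 𝓐) ∈ A) (h2 : (2 : 𝓐) ∈ A) {J k : ℕ}
    (hD : 2 ^ J ≤ D) (hk : k ≤ 2 ^ J) {F : 𝓐[X]} (hF : F.natDegree ≤ k) (hFA : coeffSet F ⊆ A)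
    (x : ℕ → 𝓐) (hx : ∀ l < 2 ^ J, x l ∈ A) :
    Computes A (8 * (J + 1) * 2 ^ J * μ)
      ((fun l => PowerSeries.coeff k ((F : PowerSeries 𝓐) * geo (x l))) '' Set.Iio (2 ^ J)) := by
  set n := 2 ^ J with hn
  have hn1 : 1 ≤ n := Nat.one_le_two_pow
  -- This factor moves the wanted coefficient from index k to index n, the number of points.
  set F' : 𝓐[X] := X ^ (n - k) * F with hF'
  have hF'deg : F'.natDegree ≤ n := by
    refine natDegree_mul_le.trans ?_
    have := natDegree_X_pow_le (R := 𝓐) (n - k)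
    omega
  have hF'A : coeffSet F' ⊆ A := by
    rintro _ ⟨l, rfl⟩
    rw [hF', coeff_X_pow_mul']
    split_ifs
    exacts [hFA (mem_coeffSet _ _), h0]
  have s₁ := Computes.subproductTree hM hμ J hZA h0 h1 hD x hx
  set A₁ := A ∪ treeSet J x with hA₁
  have hAA₁ : A ⊆ A₁ := Set.subset_union_left
  have hQA : coeffSet (subprod J x) ⊆ A₁ :=
    (coeffSet_subprod_subset _ _).trans Set.subset_union_right
  obtain ⟨B, hB, hdvd, s₂⟩ := Computes.newton hM hμ (hZA.trans hAA₁) (hAA₁ h0) (hAA₁ h1) (hAA₁ h2)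
    hn1 hD (natDegree_subprod_le J x) (subprod_coeff_zero J x) hQA (J + 1)
  have hmin : min (2 ^ (J + 1)) (n + 1) = n + 1 := by
    rw [pow_succ]; omega
  rw [hmin] at hdvd
  have s₃ := s₂.trans (hM (A₁ ∪ coeffSet B) ((hZA.trans hAA₁).trans Set.subset_union_left) n hn1 hD
    F' B hF'deg hB ((hF'A.trans hAA₁).trans Set.subset_union_left) Set.subset_union_right)
  set A₂ := A₁ ∪ coeffSet (F' * B) with hA₂
  have hAA₂ : A₁ ⊆ A₂ := Set.subset_union_left
  have s₄ := Computes.descent (A := A₂) hM (n := n) J ((hZA.trans hAA₁).trans hAA₂)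
    (hAA₂ (hAA₁ h0)) hD le_rfl x (Set.subset_union_right.trans hAA₂)
    ((F' * B : 𝓐[X]) : PowerSeries 𝓐) (fun j _ => by
      rw [Polynomial.coeff_coe]; exact .inr (mem_coeffSet _ _))
  refine (s₁.trans (s₃.trans s₄)).mono le_rfl ?_ ?_
  · have : (0 : ℝ) ≤ 2 ^ J * μ := by positivity
    rw [hn]
    push_cast
    nlinarith
  · rintro _ ⟨l, hl, rfl⟩
    refine ⟨l, hl, ?_⟩
    dsimp only
    obtain ⟨E, hE⟩ := hdvd
    -- B inverts the subproduct modulo X^(n+1), so the error does not reach the coefficient of index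
    -- n.
    have e₁ : subprod J x * (F' * B) = F' + X ^ (n + 1) * (F' * E) := by
      linear_combination F' * hE
    rw [← Polynomial.coe_mul, e₁, Polynomial.coe_add, add_mul, map_add, hF', Polynomial.coe_mul,
      Polynomial.coe_mul, Polynomial.coe_pow, Polynomial.coe_pow, Polynomial.coe_X, mul_assoc,
      mul_assoc, PowerSeries.coeff_X_pow_mul', PowerSeries.coeff_X_pow_mul', if_pos (by omega),
      if_neg (by omega), add_zero]
    congr 2
    omega

/-- From the values of a polynomial of degree at most `2 ^ i` at `0, β, …, 2 ^ i β` to its values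
at `q 2 ^ J` arbitrary points. -/
theorem Computes.multipoint {Z A : Set 𝓐} {μ : ℝ} {D : ℕ} (hM : PolyMulBound Z μ D) (hμ : 1 ≤ μ)
    (hZA : Z ⊆ A) (h0 : (0 : 𝓐) ∈ A) (h1 : (1 : 𝓐) ∈ A) (h2 : (2 : 𝓐) ∈ A) {i J : ℕ} (hiJ : i ≤ J)
    (hD : 2 ^ (J + 1) ≤ D) {β : 𝓐}
    {u : ℕ → 𝓐} (hu : ∀ j < 2 ^ i + 1, u j * ∏ l ∈ (Finset.range (2 ^ i + 1)).erase j,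
      ((j : 𝓐) * β - (l : 𝓐) * β) = 1) (huA : ∀ j < 2 ^ i + 1, u j ∈ A)
    (hyA : ∀ j : ℕ, j < 2 ^ i + 1 → (j : 𝓐) * β ∈ A)
    {f : 𝓐[X]} (hf : f.natDegree ≤ 2 ^ i) (hfA : ∀ j : ℕ, j < 2 ^ i + 1 → f.eval ((j : 𝓐) * β) ∈ A)
    (q : ℕ) (x : ℕ → 𝓐) (hx : ∀ l < q * 2 ^ J, x l ∈ A) :
    Computes A ((12 + 8 * q) * ((J + 1) * 2 ^ J * μ))
      ((fun l => f.eval (x l)) '' Set.Iio (q * 2 ^ J)) := by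
  have h2J : 2 ^ (i + 1) ≤ 2 ^ (J + 1) := Nat.pow_le_pow_right (by norm_num) (by omega)
  have h2J' : 2 ^ J ≤ 2 ^ (J + 1) := Nat.pow_le_pow_right (by norm_num) (by omega)
  obtain ⟨F, hF, hFe, s₁⟩ := Computes.interpolate hM hμ hZA h0 h1 (h2J.trans hD) hu huA hyA hf hfA
  have s₂ := s₁.trans (Computes.iUnion_lt q (fun b hb => Computes.evaluate hM hμ
    (hZA.trans Set.subset_union_left) (.inl h0) (.inl h1) (.inl h2) (h2J'.trans hD)
    (Nat.pow_le_pow_right (by norm_num) hiJ) hF Set.subset_union_right (fun l => x (b * 2 ^ J + l))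
    fun l hl => .inl (hx _ (by nlinarith))))
  refine s₂.mono le_rfl ?_ ?_
  · have h₁ : ((i : ℝ) + 1) * 2 ^ i ≤ (J + 1) * 2 ^ J := by
      have : (i : ℝ) ≤ J := by exact_mod_cast hiJ
      have : (2 : ℝ) ^ i ≤ 2 ^ J := pow_le_pow_right₀ (by norm_num) hiJ
      gcongr
    have := mul_le_mul_of_nonneg_right h₁ (by linarith : 0 ≤ μ)
    nlinarith
  · rintro _ ⟨l, hl, rfl⟩
    have hpos : 0 < 2 ^ J := by positivity
    refine Set.mem_biUnion (x := l / 2 ^ J) ((Nat.div_lt_iff_lt_mul hpos).2 hl)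
      ⟨l % 2 ^ J, Nat.mod_lt _ hpos, ?_⟩
    dsimp only
    rw [hFe, Nat.div_add_mod']

end Evaluation

/-! ### Products over arbitrary intervals -/

section Gluing

variable {𝓐 : Type u} [CommRing 𝓐] {m : ℕ} {U₀ U₁ : Matrix (Fin m) (Fin m) 𝓐}

theorem blockProd_shift (U₀ U₁ : Matrix (Fin m) (Fin m) 𝓐) (y : 𝓐) (k : ℕ) (x : 𝓐) :
    blockProd (U₀ + y • U₁) U₁ k x = blockProd U₀ U₁ k (x + y) := by
  induction k with
  | zero => rfl
  | succ k ih =>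
    rw [blockProd, blockProd, ih, add_assoc U₀, ← add_smul]
    congr 3
    ring

theorem entrySet_one_subset {A : Set 𝓐} (h0 : (0 : 𝓐) ∈ A) (h1 : (1 : 𝓐) ∈ A) :
    entrySet (1 : Matrix (Fin m) (Fin m) 𝓐) ⊆ A := by
  rintro _ ⟨⟨a, b⟩, rfl⟩
  dsimp only
  rw [Matrix.one_apply]
  split_ifs
  exacts [h1, h0]

theorem Computes.blockProd_add {Z A : Set 𝓐} {ν c : ℝ} (hMM : MatMulBound m Z ν) (hZA : Z ⊆ A)
    {k l x : ℕ} (h₁ : entrySet (blockProd U₀ U₁ k (x : 𝓐)) ⊆ A)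
    (h₂ : Computes A c (entrySet (blockProd U₀ U₁ l ((x + k : ℕ) : 𝓐)))) :
    Computes A (c + ν) (entrySet (blockProd U₀ U₁ (k + l) (x : 𝓐))) := by
  refine h₂.trans ?_
  rw [_root_.blockProd_add, ← Nat.cast_add]
  exact hMM _ (hZA.trans Set.subset_union_left) _ _ Set.subset_union_right
    (h₁.trans Set.subset_union_left)

theorem Computes.blockProd_mul {Z A : Set 𝓐} {ν : ℝ} (hMM : MatMulBound m Z ν) (hZA : Z ⊆ A)
    (h0 : (0 : 𝓐) ∈ A) (h1 : (1 : 𝓐) ∈ A) (q h x : ℕ)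
    (hA : ∀ e < q, entrySet (blockProd U₀ U₁ h ((x + e * h : ℕ) : 𝓐)) ⊆ A) :
    Computes A (q * ν) (entrySet (blockProd U₀ U₁ (q * h) (x : 𝓐))) := by
  refine Computes.iterate q (B := fun e => entrySet (blockProd U₀ U₁ (e * h) (x : 𝓐))) ?_
    fun e he => ?_
  · rw [zero_mul]
    exact entrySet_one_subset h0 h1
  · rw [add_mul, one_mul, _root_.blockProd_add, ← Nat.cast_add]
    exact hMM _ (hZA.trans Set.subset_union_left) _ _
      ((hA e he).trans Set.subset_union_left) Set.subset_union_right

/-- A product of fewer than `2 ^ i` factors from products of `2 ^ j` factors, `j < i`. -/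
theorem exists_binary_blocks {Z : Set 𝓐} {ν : ℝ} (hMM : MatMulBound m Z ν) (hν : 0 ≤ ν) (i : ℕ) :
    ∀ x len : ℕ, len < 2 ^ i → ∃ y : ℕ → ℕ, (∀ j, y j ≤ x + len) ∧
      ∀ A : Set 𝓐, Z ⊆ A → (0 : 𝓐) ∈ A → (1 : 𝓐) ∈ A →
        (∀ j < i, entrySet (blockProd U₀ U₁ (2 ^ j) (y j : 𝓐)) ⊆ A) →
        Computes A (i * ν) (entrySet (blockProd U₀ U₁ len (x : 𝓐))) := by
  induction i with
  | zero =>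
    intro x len hlen
    obtain rfl : len = 0 := by simpa using hlen
    exact ⟨fun _ => x, fun _ => le_rfl, fun A _ h0 h1 _ =>
      Computes.of_subset (entrySet_one_subset h0 h1) (by simp)⟩
  | succ i ih =>
    intro x len hlen
    by_cases h : len < 2 ^ i
    · obtain ⟨y, hy, hA⟩ := ih x len h
      refine ⟨y, hy, fun A hZ h0 h1 hyA => (hA A hZ h0 h1 fun j hj => hyA j (by omega)).mono_cost ?_⟩
      push_cast
      linarith
    · rw [pow_succ] at hlen
      obtain ⟨y, hy, hA⟩ := ih (x + 2 ^ i) (len - 2 ^ i) (by omega)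
      -- The leading binary digit is 1: the block of length 2^i starts at x and the rest follows it.
      -- Starting points for digits 0 are arbitrary, but they too obey the bound.
      refine ⟨Function.update y i x, fun j => ?_, fun A hZ h0 h1 hyA => ?_⟩
      · by_cases hj : j = i
        · subst hj; simp
        · rw [Function.update_of_ne hj]
          have := hy j
          omega
      · have h₁ := hyA i (by omega)
        rw [Function.update_self] at h₁
        have h₂ := hA A hZ h0 h1 fun j hj => by
          have := hyA j (by omega)
          rwa [Function.update_of_ne (by omega)] at this
        have := Computes.blockProd_add hMM hZ h₁ h₂
        rw [show 2 ^ i + (len - 2 ^ i) = len by omega] at this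
        refine this.mono_cost ?_
        push_cast
        linarith

/-- A product of fewer than `2 ^ s` factors from products of `2 ^ i` factors, `i ≤ J`. -/
theorem exists_blocks {Z : Set 𝓐} {ν : ℝ} (hMM : MatMulBound m Z ν) (hν : 0 ≤ ν) {J s : ℕ}
    (hJ : J ≤ s) (x len : ℕ) (hlen : len < 2 ^ s) : ∃ y : ℕ → ℕ → ℕ,
      (∀ i, ∀ e < 2 ^ (s - J), y i e ≤ x + len + 2 ^ s) ∧
      ∀ A : Set 𝓐, Z ⊆ A → (0 : 𝓐) ∈ A → (1 : 𝓐) ∈ A →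
        (∀ i ≤ J, ∀ e < 2 ^ (s - J), entrySet (blockProd U₀ U₁ (2 ^ i) (y i e : 𝓐)) ⊆ A) →
        Computes A ((2 ^ (s - J) + J + 1) * ν) (entrySet (blockProd U₀ U₁ len (x : 𝓐))) := by
  have hpow : 2 ^ (s - J) * 2 ^ J = 2 ^ s := by rw [← pow_add]; congr 1; omega
  have hposJ : 0 < 2 ^ J := by positivity
  have hq : len / 2 ^ J < 2 ^ (s - J) := by
    rw [Nat.div_lt_iff_lt_mul hposJ, hpow]; exact hlen
  have hlen' := Nat.div_add_mod' len (2 ^ J)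
  obtain ⟨y, hy, hA⟩ := exists_binary_blocks (U₀ := U₀) (U₁ := U₁) hMM hν J
    (x + len / 2 ^ J * 2 ^ J) (len % 2 ^ J) (Nat.mod_lt _ hposJ)
  -- The greatest length 2^J may occur many times, indexed by e; each smaller one occurs at most
  -- once. Values of e beyond the last block only cost the extra 2^s in the bound.
  refine ⟨fun i e => if i = J then x + e * 2 ^ J else y i, fun i e he => ?_,
    fun A hZ h0 h1 hyA => ?_⟩
  · dsimp only
    split_ifs
    · have := Nat.mul_le_mul_right (2 ^ J) he.le
      omega
    · have := hy i
      omega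
  · have h₁ := Computes.blockProd_mul (U₀ := U₀) (U₁ := U₁) hMM hZ h0 h1 (len / 2 ^ J) (2 ^ J) x
      fun e he => by simpa using hyA J le_rfl e (he.trans hq)
    have h₂ := hA A hZ h0 h1 fun j hj => by
      have := hyA j hj.le 0 (by positivity)
      dsimp only at this
      rwa [if_neg hj.ne] at this
    have h₃ := h₁.trans (Computes.blockProd_add hMM (hZ.trans Set.subset_union_left)
      Set.subset_union_right (h₂.mono_left Set.subset_union_left))
    rw [hlen'] at h₃
    refine h₃.mono_cost ?_
    have : ((len / 2 ^ J : ℕ) : ℝ) ≤ 2 ^ (s - J) := by exact_mod_cast hq.le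
    nlinarith [mul_le_mul_of_nonneg_right this hν]

/-- Here at is the least multiple of t that is at least k. If it exceeds l, the whole interval is
shorter than t and serves as the first end piece; no alignment is needed then. -/
theorem exists_interval_split {t : ℕ} (ht : 0 < t) {k l : ℕ} (hkl : k ≤ l) :
    ∃ a n len₁ len₂ : ℕ, len₁ < t ∧ len₂ < t ∧ l = k + len₁ + n * t + len₂ ∧
      (n = 0 ∨ k + len₁ = a * t) := by
  set a := (k + t - 1) / t with ha
  have h₁ : a * t ≤ k + t - 1 := Nat.div_mul_le_self _ _
  have h₂ : k + t - 1 < (a + 1) * t := Nat.lt_mul_of_div_lt (by omega) ht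
  rw [add_mul, one_mul] at h₂
  by_cases h : a * t ≤ l
  · have h₃ := Nat.div_add_mod' l t
    have h₄ : a ≤ l / t := (Nat.le_div_iff_mul_le ht).2 h
    have h₅ := Nat.mul_le_mul_right t h₄
    have h₆ := Nat.mod_lt l ht
    refine ⟨a, l / t - a, a * t - k, l % t, by omega, h₆, ?_, .inr (by omega)⟩
    rw [Nat.sub_mul]
    omega
  · exact ⟨a, 0, l - k, 0, by omega, ht, by omega, .inl rfl⟩

theorem Computes.multipoint_fintype {Z A : Set 𝓐} {μ : ℝ} {D : ℕ} (hM : PolyMulBound Z μ D)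
    (hμ : 1 ≤ μ) (hZA : Z ⊆ A) (h0 : (0 : 𝓐) ∈ A) (h1 : (1 : 𝓐) ∈ A) (h2 : (2 : 𝓐) ∈ A)
    {i J s : ℕ} (hiJ : i ≤ J) (hJ : J < s) (hD : 2 ^ s ≤ D) {β : 𝓐} (S : ShiftData A β (2 ^ i))
    (hyA : ∀ j : ℕ, j < 2 ^ i + 1 → (j : 𝓐) * β ∈ A) (hG : gridSet U₀ U₁ β (2 ^ i) ⊆ A)
    {κ : Type*} [Fintype κ] {q : ℕ} (hκ : Fintype.card κ ≤ q * 2 ^ J) (x : κ → 𝓐)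
    (hx : ∀ c, x c ∈ A) :
    Computes A (m ^ 2 * ((12 + 8 * q) * ((J + 1) * 2 ^ J * μ)))
      (⋃ c, entrySet (blockProd U₀ U₁ (2 ^ i) (x c))) := by
  choose p hp hpe using exists_poly_blockProd U₀ U₁ (2 ^ i)
  let φ := Fintype.equivFin κ
  -- The list of points is filled up with 0 to complete batches of 2^J.
  let x' : ℕ → 𝓐 := fun l => if h : l < Fintype.card κ then x (φ.symm ⟨l, h⟩) else 0
  have hx' : ∀ l, x' l ∈ A := fun l => by
    dsimp only [x']
    split_ifs
    exacts [hx _, h0]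
  have hD' : 2 ^ (J + 1) ≤ D := (Nat.pow_le_pow_right (by norm_num) hJ).trans hD
  have key := Computes.iUnion (κ := Fin m × Fin m) fun ab =>
    Computes.multipoint hM hμ hZA h0 h1 h2 hiJ hD' S.u_mul S.u_mem hyA (hp ab.1 ab.2)
      (fun j hj => by rw [hpe]; exact hG (mem_gridSet hj _ _)) q x' fun l _ => hx' l
  refine key.mono le_rfl (by simp [sq]) ?_
  refine Set.iUnion_subset fun c => ?_
  rintro _ ⟨⟨a, b⟩, rfl⟩
  refine Set.mem_iUnion.2 ⟨(a, b), φ c, lt_of_lt_of_le (φ c).2 hκ, ?_⟩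
  simp [x', hpe]

end Gluing

/-! ### Assembling the products over all intervals -/

section AllIntervals

variable {𝓐 : Type u} [CommRing 𝓐] {m : ℕ} {U₀ U₁ : Matrix (Fin m) (Fin m) 𝓐}

/-- Two digits in base t suffice; listing all integers up to 8t² would be too expensive. -/
theorem Computes.natCast {T : Set 𝓐} {t : ℕ} (ht : 0 < t)
    (hN : ∀ n : ℕ, n ≤ 8 * t → (n : 𝓐) ∈ T) {x : ℕ} (hx : x < 8 * t * t) :
    Computes T 2 {(x : 𝓐)} := by
  have h₁ : x / t < 8 * t := (Nat.div_lt_iff_lt_mul ht).2 hx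
  have h₂ : x % t < t := Nat.mod_lt _ ht
  have s₁ := Computes.mul (hN (x / t) h₁.le) (hN t (by omega))
  have s₂ := s₁.trans (Computes.add (.inr rfl) (.inl (hN (x % t) (by omega))))
  rw [← Nat.cast_mul, ← Nat.cast_add, Nat.div_add_mod'] at s₂
  exact s₂.mono_cost (by norm_num)

theorem mem_gridSets {s i j : ℕ} (hi : i ≤ s) (hj : j < 2 ^ i + 1) (a b : Fin m) :
    blockProd U₀ U₁ (2 ^ i) ((j : 𝓐) * ((2 ^ s : ℕ) : 𝓐)) a b ∈
      ⋃ i ∈ Set.Iio (s + 1), gridSet U₀ U₁ ((2 ^ s : ℕ) : 𝓐) (2 ^ i) :=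
  Set.mem_biUnion (show i ∈ Set.Iio (s + 1) from Nat.lt_succ_of_le hi) (mem_gridSet hj a b)

/-- The products of length `2 ^ s` at all multiples of `2 ^ s` below `4 ⬝ 4 ^ s`. -/
theorem Computes.alignedBlocks {Z T : Set 𝓐} {μ ν : ℝ} {D : ℕ} (hM : PolyMulBound Z μ D)
    (hμ : 1 ≤ μ) (hMM : MatMulBound m Z ν) (hν : 0 ≤ ν) (hZT : Z ⊆ T) (h0 : (0 : 𝓐) ∈ T)
    (h1 : (1 : 𝓐) ∈ T) {s : ℕ} (hsD : 2 ^ s ≤ D) (hN : ∀ n : ℕ, n ≤ 8 * 2 ^ s → (n : 𝓐) ∈ T)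
    (hS : ∀ i < s, Nonempty (ShiftData T ((2 ^ s : ℕ) : 𝓐) (2 ^ i)))
    (h₀ : entrySet U₀ ⊆ T) (h₁ : entrySet U₁ ⊆ T) :
    Computes T (4 * (1 + (m ^ 2 * 2 + (m ^ 2 * (49 * μ * 2 ^ s) + 3 * 2 ^ s * ν))))
      (⋃ c ∈ Set.Iio (4 * 2 ^ s),
        entrySet (blockProd U₀ U₁ (2 ^ s) ((c * 2 ^ s : ℕ) : 𝓐))) := by
  set t := 2 ^ s with ht
  have htpos : 0 < t := by positivity
  have hy : ∀ d < 4, ((d * t : ℕ) : 𝓐) ∈ T := fun d hd => hN _ (by nlinarith)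
  -- Write c = dt + j with j < t and d < 4: the block at ct is the grid value at jt for the matrix
  -- translated by dt².
  have key := Computes.iUnion_lt (A := T) 4
    (c := 1 + (m ^ 2 * 2 + (m ^ 2 * (49 * μ * 2 ^ s) + 3 * 2 ^ s * ν)))
    (B := fun d => ⋃ i ∈ Set.Iio (s + 1),
      gridSet (U₀ + (((d * t : ℕ) : 𝓐) * (t : 𝓐)) • U₁) U₁ (t : 𝓐) (2 ^ i)) fun d hd => ?_
  · refine key.mono le_rfl (by push_cast; exact le_rfl) ?_
    refine Set.iUnion₂_subset fun c hc => ?_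
    have hc' : c / t < 4 := (Nat.div_lt_iff_lt_mul htpos).2 hc
    rintro _ ⟨⟨a, b⟩, rfl⟩
    refine Set.mem_biUnion (show c / t ∈ Set.Iio 4 from hc') ?_
    have hmod : c % t < 2 ^ s + 1 := (Nat.mod_lt c htpos).trans (Nat.lt_succ_self _)
    have := mem_gridSets (U₀ := U₀ + (((c / t * t : ℕ) : 𝓐) * (t : 𝓐)) • U₁) (U₁ := U₁)
      (le_refl s) hmod a b
    rw [blockProd_shift, ← ht, ← add_mul, ← Nat.cast_add, add_comm (c % t), Nat.div_add_mod'] at this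
    simp only [Nat.cast_mul] at this ⊢
    exact this
  · have s₁ := Computes.mul (hy d hd) (hN t (by omega))
    set y : 𝓐 := ((d * t : ℕ) : 𝓐) * (t : 𝓐)
    have s₂ : Computes (T ∪ {y}) (m ^ 2 * 2) (entrySet (U₀ + y • U₁)) :=
      Computes.entrySet_affine (.inr rfl) (h₀.trans Set.subset_union_left)
        (h₁.trans Set.subset_union_left)
    have hsub : T ⊆ T ∪ {y} ∪ entrySet (U₀ + y • U₁) :=
      Set.subset_union_left.trans Set.subset_union_left
    exact s₁.trans (s₂.trans (Computes.gridSets hM hμ hMM (hZT.trans hsub) (hsub h0) (hsub h1) hsD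
      (fun n hn => hsub (hN n hn)) (fun i hi => (hS i hi).elim fun S => S.mono hsub)
      Set.subset_union_right (h₁.trans hsub) hν))

/-- The products of `2 ^ i` factors, `i ≤ J`, at arbitrary points. -/
theorem Computes.scatteredBlocks {Z A : Set 𝓐} {μ : ℝ} {D : ℕ} (hM : PolyMulBound Z μ D)
    (hμ : 1 ≤ μ) (hZA : Z ⊆ A) (h0 : (0 : 𝓐) ∈ A) (h1 : (1 : 𝓐) ∈ A) {J s : ℕ} (hJ : J < s)
    (hsD : 2 ^ s ≤ D) (hN : ∀ n : ℕ, n ≤ 8 * 2 ^ s → (n : 𝓐) ∈ A)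
    (hS : ∀ i < s, Nonempty (ShiftData A ((2 ^ s : ℕ) : 𝓐) (2 ^ i)))
    (hG : ∀ i < s, gridSet U₀ U₁ ((2 ^ s : ℕ) : 𝓐) (2 ^ i) ⊆ A)
    {κ : Type*} [Fintype κ] {q : ℕ} (hκ : Fintype.card κ ≤ q * 2 ^ J) (pt : ℕ → κ → ℕ)
    (hpt : ∀ i c, pt i c < 8 * 2 ^ s * 2 ^ s) :
    Computes A ((J + 1) * (Fintype.card κ * 2 +
        m ^ 2 * ((12 + 8 * q) * ((J + 1) * 2 ^ J * μ))))
      (⋃ i ∈ Set.Iio (J + 1), ⋃ c, entrySet (blockProd U₀ U₁ (2 ^ i) (pt i c : 𝓐))) := by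
  have key := Computes.iUnion_lt (A := A) (J + 1)
    (c := Fintype.card κ * 2 + m ^ 2 * ((12 + 8 * q) * ((J + 1) * 2 ^ J * μ)))
    (B := fun i => ⋃ c, entrySet (blockProd U₀ U₁ (2 ^ i) (pt i c : 𝓐))) fun i hi => ?_
  · refine key.mono_cost ?_
    push_cast
    exact le_rfl
  · have s₁ := Computes.iUnion fun c => Computes.natCast (T := A) (by positivity) hN (hpt i c)
    obtain ⟨S'⟩ := hS i (by omega)
    have hsub := Set.subset_union_left (s := A) (t := ⋃ c, {(pt i c : 𝓐)})
    obtain ⟨S⟩ := S'.mono hsub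
    have hyA : ∀ j : ℕ, j < 2 ^ i + 1 → (j : 𝓐) * ((2 ^ s : ℕ) : 𝓐) ∈ A ∪ ⋃ c, {(pt i c : 𝓐)} := by
      intro j hj
      rcases j with _ | e
      · simpa using Or.inl h0
      -- (e + 1)β is the argument (k + 1)β + (e - k)β of the far shift, with k = 2^i.
      · have := S.far_arg_mem e (by omega)
        convert this using 1
        push_cast
        ring
    refine s₁.trans (Computes.multipoint_fintype hM hμ (hZA.trans hsub) (hsub h0) (hsub h1)
      (hsub ?_) (by omega) hJ hsD S hyA ((hG i (by omega)).trans hsub) hκ (fun c => (pt i c : 𝓐))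
      fun c => .inr (Set.mem_iUnion.2 ⟨c, rfl⟩))
    have : 1 ≤ 2 ^ s := Nat.one_le_two_pow
    have := hN 2 (by omega)
    simpa using this

theorem Computes.blockProd_three {Z A : Set 𝓐} {ν c₁ c₂ c₃ : ℝ} (hMM : MatMulBound m Z ν)
    (hZA : Z ⊆ A) {x k₁ k₂ k₃ : ℕ} (h₁ : Computes A c₁ (entrySet (blockProd U₀ U₁ k₁ (x : 𝓐))))
    (h₂ : Computes A c₂ (entrySet (blockProd U₀ U₁ k₂ ((x + k₁ : ℕ) : 𝓐))))
    (h₃ : Computes A c₃ (entrySet (blockProd U₀ U₁ k₃ ((x + k₁ + k₂ : ℕ) : 𝓐)))) :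
    Computes A (c₁ + c₂ + c₃ + 2 * ν) (entrySet (blockProd U₀ U₁ (k₁ + k₂ + k₃) (x : 𝓐))) := by
  have s₁ := h₂.trans (Computes.blockProd_add hMM (hZA.trans Set.subset_union_left)
    Set.subset_union_right (h₃.mono_left Set.subset_union_left))
  have s₂ := h₁.trans (Computes.blockProd_add hMM (hZA.trans Set.subset_union_left)
    Set.subset_union_right (s₁.mono_left Set.subset_union_left))
  rw [add_assoc k₁]
  exact s₂.mono_cost (by linarith)

/-- The summands are, in order, the precomputation, the aligned blocks, the grids, the scattered
blocks and the final matrix products. Only the scattered blocks and the gluing of end pieces depend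
on r, and the bound with W controls both. -/
theorem intervalProducts_cost_le {μ ν W : ℝ} (hμ : 1 ≤ μ) (hν : 0 ≤ ν) {m s J r q κ : ℕ}
    (hm : 1 ≤ m) {n : Fin r → ℕ} (hκ : (κ : ℝ) = r * 2 * 2 ^ (s - J))
    (hq : (q : ℝ) * 2 ^ J ≤ r * 2 * 2 ^ (s - J) + 2 ^ J) (hn : ∑ i, (n i : ℝ) ≤ 4 * 2 ^ s)
    (hW : ((J : ℝ) + 1) ^ 2 * (r * 2 ^ (s - J) + 2 ^ J) ≤ W * 2 ^ s) :
    91 * 2 ^ s + (4 * (1 + (m ^ 2 * 2 + (m ^ 2 * (49 * μ * 2 ^ s) + 3 * 2 ^ s * ν))) +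
      (m ^ 2 * (49 * μ * 2 ^ s) + 3 * 2 ^ s * ν + (J + 1) * (κ * 2 +
        m ^ 2 * ((12 + 8 * q) * ((J + 1) * 2 ^ J * μ))))) +
      ∑ i, ((2 ^ (s - J) + J + 1) * ν + n i * ν + (2 ^ (s - J) + J + 1) * ν + 2 * ν) ≤
      (400 + 24 * W) * (m ^ 2 * μ * 2 ^ s + ν * 2 ^ s) := by
  have hsum : ∑ i, ((2 ^ (s - J) + J + 1) * ν + n i * ν + (2 ^ (s - J) + J + 1) * ν + 2 * ν) =
      (r * (2 * 2 ^ (s - J) + 2 * (J + 1) + 2) + ∑ i, (n i : ℝ)) * ν := by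
    simp only [Finset.sum_add_distrib, ← Finset.sum_mul, Finset.sum_const, Finset.card_univ,
      Fintype.card_fin, nsmul_eq_mul]
    ring
  rw [hsum, hκ]
  have hg : (1 : ℝ) ≤ 2 ^ (s - J) := one_le_pow₀ (by norm_num)
  have hh : (1 : ℝ) ≤ 2 ^ J := one_le_pow₀ (by norm_num)
  have ht : (1 : ℝ) ≤ 2 ^ s := one_le_pow₀ (by norm_num)
  have hX : (1 : ℝ) ≤ (J : ℝ) + 1 := by linarith [(Nat.cast_nonneg J : (0 : ℝ) ≤ J)]
  have hr : (0 : ℝ) ≤ r := Nat.cast_nonneg r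
  have hm' : (1 : ℝ) ≤ (m : ℝ) ^ 2 := one_le_pow₀ (by exact_mod_cast hm)
  generalize (2 : ℝ) ^ (s - J) = g at *
  generalize (2 : ℝ) ^ J = h at *
  generalize (2 : ℝ) ^ s = t at *
  generalize (J : ℝ) + 1 = x at *
  generalize (m : ℝ) ^ 2 = p at *
  generalize ∑ i, (n i : ℝ) = y at *
  have hxx : x ≤ x ^ 2 := by nlinarith
  have hx2 : 1 ≤ x ^ 2 := by nlinarith
  have hpμ : 1 ≤ p * μ := by nlinarith
  have hrg : 0 ≤ r * g := by positivity
  have hrg' : (r : ℝ) ≤ r * g := le_mul_of_one_le_right hr hg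
  have b₁ : x ^ 2 * (r * g) ≤ W * t := by nlinarith [mul_nonneg (sq_nonneg x) (by linarith : 0 ≤ h)]
  have b₂ : r * g ≤ W * t := by nlinarith
  have b₃ : r * x ≤ W * t := by nlinarith
  have c₁ : (r * (2 * g + 2 * x + 2) + y) * ν ≤ (6 * (W * t) + 4 * t) * ν :=
    mul_le_mul_of_nonneg_right (by nlinarith) hν
  have c₂ : x * (r * 2 * g * 2) ≤ p * μ * (4 * (W * t)) := by
    have h₁ : x * (r * 2 * g * 2) ≤ 4 * (W * t) := by nlinarith
    have h₂ : 0 ≤ 4 * (W * t) := by linarith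
    nlinarith
  have c₃ : x * (p * ((12 + 8 * q) * (x * h * μ))) ≤ p * μ * (20 * (W * t)) := by
    have h₁ : (12 + 8 * (q : ℝ)) * h ≤ 20 * (r * g + h) := by nlinarith
    have h₂ := mul_le_mul_of_nonneg_left h₁ (sq_nonneg x)
    have h₃ : x ^ 2 * ((12 + 8 * (q : ℝ)) * h) ≤ 20 * (W * t) := by linarith
    have h₄ := mul_le_mul_of_nonneg_left h₃ (by linarith : 0 ≤ p * μ)
    linarith
  have c₄ : t ≤ p * μ * t := le_mul_of_one_le_left (by linarith) hpμ
  have c₅ : p * 2 ≤ 2 * (p * μ * t) := by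
    have : p ≤ p * (μ * t) := le_mul_of_one_le_right (by linarith) (by nlinarith)
    linarith
  have c₆ : 0 ≤ W * t * ν := mul_nonneg (by linarith) hν
  have c₇ : 0 ≤ t * ν := mul_nonneg (by linarith) hν
  have c₈ : (1 : ℝ) ≤ p * μ * t := by linarith
  linarith

theorem Computes.intervalProducts {Z A : Set 𝓐} {μ ν W : ℝ} {D : ℕ} (hM : PolyMulBound Z μ D)
    (hμ : 1 ≤ μ) (hMM : MatMulBound m Z ν) (hν : 0 ≤ ν) (hZA : Z ⊆ A) (h0 : (0 : 𝓐) ∈ A)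
    (h1 : (1 : 𝓐) ∈ A) {s : ℕ} {δ : 𝓐} (hδA : δ ∈ A) (hδ : δ * bgsD 1 (2 ^ s) (2 ^ s) = 1)
    (h₀ : entrySet U₀ ⊆ A) (h₁ : entrySet U₁ ⊆ A) (hm : 1 ≤ m) {J : ℕ} (hJ : J < s)
    (hsD : 2 ^ s ≤ D) {r : ℕ} {k l : Fin r → ℕ} (hkl : ∀ i, k i ≤ l i)
    (hl : ∀ i, l i < 4 * 2 ^ s * 2 ^ s) (hsum : ∑ i, (l i - k i) ≤ 4 * 2 ^ s * 2 ^ s)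
    (hW : ((J : ℝ) + 1) ^ 2 * (r * 2 ^ (s - J) + 2 ^ J) ≤ W * 2 ^ s) :
    Computes A ((400 + 24 * W) * (m ^ 2 * μ * 2 ^ s + ν * 2 ^ s))
      (⋃ i, entrySet (blockProd U₀ U₁ (l i - k i) (k i : 𝓐))) := by
  have htpos : 0 < 2 ^ s := by positivity
  obtain ⟨T, hAT, sT, hN, hS⟩ := Computes.exists_shiftData h0 h1 hδA hδ
  choose a n len₁ len₂ hlen₁ hlen₂ hsplit halign using fun i => exists_interval_split htpos (hkl i)
  choose y₁ hy₁ hy₁A using fun i =>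
    exists_blocks (U₀ := U₀) (U₁ := U₁) hMM hν hJ.le (k i) (len₁ i) (hlen₁ i)
  choose y₂ hy₂ hy₂A using fun i =>
    exists_blocks (U₀ := U₀) (U₁ := U₁) hMM hν hJ.le (k i + len₁ i + n i * 2 ^ s) (len₂ i)
      (hlen₂ i)
  -- All starting points of blocks of length 2^i: the Boolean selects the first or the second end
  -- piece of an interval.
  let pt : ℕ → (Fin r × Bool) × Fin (2 ^ (s - J)) → ℕ := fun i c =>
    if c.1.2 then y₁ c.1.1 i c.2 else y₂ c.1.1 i c.2
  have hbig : 2 ^ s ≤ 2 ^ s * 2 ^ s := Nat.le_mul_of_pos_left _ htpos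
  have hpt : ∀ i c, pt i c < 8 * 2 ^ s * 2 ^ s := by
    rintro i ⟨⟨j, b⟩, e⟩
    have e₁ := hy₁ j i e e.2
    have e₂ := hy₂ j i e e.2
    have e₃ := hsplit j
    have e₄ := hl j
    rw [mul_assoc] at e₄ ⊢
    dsimp only [pt]
    split_ifs <;> omega
  have hcard : Fintype.card ((Fin r × Bool) × Fin (2 ^ (s - J))) = r * 2 * 2 ^ (s - J) := by simp
  set q := r * 2 * 2 ^ (s - J) / 2 ^ J + 1 with hq
  have hκ : Fintype.card ((Fin r × Bool) × Fin (2 ^ (s - J))) ≤ q * 2 ^ J := by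
    rw [hcard, hq]
    exact (Nat.lt_mul_of_div_lt (Nat.lt_succ_self _) (by positivity)).le
  have hqle : q * 2 ^ J ≤ r * 2 * 2 ^ (s - J) + 2 ^ J := by
    rw [hq, add_mul, one_mul]
    exact Nat.add_le_add_right (Nat.div_mul_le_self _ _) _
  -- the grids, the aligned blocks and the scattered blocks
  have sG := Computes.gridSets (U₀ := U₀) (U₁ := U₁) hM hμ hMM (hZA.trans hAT) (hAT h0) (hAT h1)
    hsD hN hS (h₀.trans hAT) (h₁.trans hAT) hν
  have sB := Computes.alignedBlocks (U₀ := U₀) (U₁ := U₁) hM hμ hMM hν (hZA.trans hAT) (hAT h0)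
    (hAT h1) hsD hN hS (h₀.trans hAT) (h₁.trans hAT)
  set G := ⋃ i ∈ Set.Iio (s + 1), gridSet U₀ U₁ ((2 ^ s : ℕ) : 𝓐) (2 ^ i) with hG
  set B := ⋃ c ∈ Set.Iio (4 * 2 ^ s), entrySet (blockProd U₀ U₁ (2 ^ s) ((c * 2 ^ s : ℕ) : 𝓐))
    with hB
  have hTG : T ⊆ T ∪ G := Set.subset_union_left
  have sC := sG.trans (Computes.scatteredBlocks (U₀ := U₀) (U₁ := U₁) hM hμ
    ((hZA.trans hAT).trans hTG) (hTG (hAT h0)) (hTG (hAT h1)) hJ hsD (fun n hn => hTG (hN n hn))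
    (fun i hi => (hS i hi).elim fun S => S.mono hTG)
    (fun i hi => (Set.subset_biUnion_of_mem (u := fun i => gridSet U₀ U₁ ((2 ^ s : ℕ) : 𝓐) (2 ^ i))
      (show i ∈ Set.Iio (s + 1) from hi.trans (Nat.lt_succ_self s))).trans Set.subset_union_right)
    hκ pt hpt)
  set V := ⋃ i ∈ Set.Iio (J + 1), ⋃ c, entrySet (blockProd U₀ U₁ (2 ^ i) (pt i c : 𝓐)) with hV
  have sAll := sT.trans ((sB.union sC).mono_left (Set.subset_union_right (s := A)))
  have hsub : A ⊆ A ∪ (B ∪ V) := Set.subset_union_left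
  have hBsub : ∀ c < 4 * 2 ^ s,
      entrySet (blockProd U₀ U₁ (2 ^ s) ((c * 2 ^ s : ℕ) : 𝓐)) ⊆ A ∪ (B ∪ V) := fun c hc =>
    (Set.subset_biUnion_of_mem (u := fun c : ℕ =>
      entrySet (blockProd U₀ U₁ (2 ^ s) ((c * 2 ^ s : ℕ) : 𝓐))) (show c ∈ Set.Iio (4 * 2 ^ s)
      from hc)).trans (Set.subset_union_left.trans Set.subset_union_right)
  have hVsub : ∀ i ≤ J, ∀ c, entrySet (blockProd U₀ U₁ (2 ^ i) (pt i c : 𝓐)) ⊆ A ∪ (B ∪ V) :=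
    fun i hi c => (Set.subset_iUnion _ c).trans ((Set.subset_biUnion_of_mem
      (u := fun i => ⋃ c, entrySet (blockProd U₀ U₁ (2 ^ i) (pt i c : 𝓐)))
      (show i ∈ Set.Iio (J + 1) from Nat.lt_succ_of_le hi)).trans
        (Set.subset_union_right.trans Set.subset_union_right))
  have sQ := Computes.biUnion (A := A ∪ (B ∪ V)) Finset.univ
    (f := fun i => (2 ^ (s - J) + J + 1) * ν + n i * ν + (2 ^ (s - J) + J + 1) * ν + 2 * ν)
    (B := fun i => entrySet (blockProd U₀ U₁ (l i - k i) (k i : 𝓐))) fun i _ => by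
      have q₁ := hy₁A i (A ∪ (B ∪ V)) (hZA.trans hsub) (hsub h0) (hsub h1) fun j hj e he =>
        hVsub j hj ((i, true), ⟨e, he⟩)
      have q₂ := hy₂A i (A ∪ (B ∪ V)) (hZA.trans hsub) (hsub h0) (hsub h1) fun j hj e he =>
        hVsub j hj ((i, false), ⟨e, he⟩)
      have q₃ := Computes.blockProd_mul (U₀ := U₀) (U₁ := U₁) hMM (hZA.trans hsub) (hsub h0)
        (hsub h1) (n i) (2 ^ s) (k i + len₁ i) fun e he => by
          rcases halign i with h | h
          · omega
          · rw [h, ← add_mul]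
            refine hBsub _ ?_
            have e₁ := hsplit i
            have e₂ := hl i
            -- The aligned block ends no later than the interval, hence below 4t², which bounds its
            -- index by 4t.
            have e₃ : (e + 1) * 2 ^ s ≤ n i * 2 ^ s := Nat.mul_le_mul_right _ he
            refine Nat.lt_of_mul_lt_mul_right (a := 2 ^ s) ?_
            rw [add_mul] at e₃ ⊢
            omega
      have := Computes.blockProd_three hMM (hZA.trans hsub) q₁ q₃ q₂
      rwa [show len₁ i + n i * 2 ^ s + len₂ i = l i - k i by have := hsplit i; omega] at this
  refine (sAll.trans sQ).mono le_rfl ?_ (by simp)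
  have hn : ∑ i, n i ≤ 4 * 2 ^ s := by
    refine Nat.le_of_mul_le_mul_right (c := 2 ^ s) ?_ htpos
    rw [Finset.sum_mul]
    refine (Finset.sum_le_sum fun i _ => ?_).trans hsum
    have := hsplit i
    omega
  exact intervalProducts_cost_le hμ hν hm (by rw [hcard]; push_cast; rfl) (by exact_mod_cast hqle)
    (by exact_mod_cast hn) hW

end AllIntervals

/-! ### Transfer to straight-line programs -/

section Transfer

variable {R : Type u} [CommRing R] {𝓐 : Type v} [CommRing 𝓐] {m : ℕ}

theorem map_bgsD (φ : 𝓐 →+* R) (α β : 𝓐) (k : ℕ) :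
    φ (bgsD α β k) = bgsD (φ α) (φ β) k := by
  simp [bgsD, shiftDenominator]

theorem map_blockProd (φ : 𝓐 →+* R) (U₀ U₁ : Matrix (Fin m) (Fin m) 𝓐) (k : ℕ) (x : 𝓐) :
    (blockProd U₀ U₁ k x).map φ = blockProd (U₀.map φ) (U₁.map φ) k (φ x) := by
  induction k with
  | zero => exact Matrix.map_one φ (map_zero φ) (map_one φ)
  | succ k ih =>
    rw [blockProd, blockProd, Matrix.map_mul, ih]
    congr 1
    ext a b
    simp

theorem evalAt_eq {N : Matrix (Fin m) (Fin m) R[X]} (hN : ∀ a b, (N a b).natDegree ≤ 1) (x : R) :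
    N.evalAt x = N.map (fun p => p.coeff 0) + x • N.map fun p => p.coeff 1 := by
  ext a b
  simp only [Matrix.evalAt, Matrix.map_apply, Matrix.add_apply, Matrix.smul_apply, smul_eq_mul]
  rw [eval_eq_sum_range' (Nat.lt_succ_of_le (hN a b)), Finset.sum_range_succ,
    Finset.sum_range_one]
  ring

theorem intervalProduct_eq_blockProd {N : Matrix (Fin m) (Fin m) R[X]}
    (hN : ∀ a b, (N a b).natDegree ≤ 1) {k l : ℕ} (hkl : k ≤ l) :
    intervalProduct N k l =
      blockProd (N.map fun p => p.coeff 0) (N.map fun p => p.coeff 1) (l - k) (k : R) := by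
  obtain ⟨n, rfl⟩ := Nat.exists_eq_add_of_le hkl
  rw [intervalProduct, Nat.add_sub_cancel_left]
  clear hkl
  induction n with
  | zero => simp [blockProd]
  | succ n ih =>
    rw [List.range'_concat, List.map_append, List.reverse_append, List.prod_append, ih, blockProd]
    congr 1
    simp only [List.map_singleton, List.reverse_singleton, List.prod_singleton, evalAt_eq hN]
    congr 2
    push_cast
    ring

/-- Without instructions an output is a constant or a copied input. The constant terms of 1·1, 1·0
and 0·1 rule this out. -/
theorem one_le_polyMulCost [Nontrivial R] {S : Set R} {M : ℕ → ℕ} (h : IsPolyMulCost S M) :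
    1 ≤ M 1 := by
  by_contra hM
  obtain ⟨P, -, hc, hP⟩ := h 1 le_rfl
  have hcode : P.code = [] := List.length_eq_zero_iff.1 (by
    have : P.code.length ≤ M 1 := hc
    omega)
  have h11 := hP 1 1 (by simp) (by simp) 0
  have h10 := hP 1 0 (by simp) (by simp) 0
  have h01 := hP 0 1 (by simp) (by simp) 0
  simp only [StraightLineProgram.eval, StraightLineProgram.results, hcode, List.foldl_nil] at *
  cases hout : P.output 0 with
  | const c =>
    simp only [hout, Operand.value] at *
    simp_all
  | input i =>
    simp only [hout, Operand.value] at *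
    rcases i with i | i
    · simp only [Sum.elim_inl] at h11 h10
      rw [h11] at h10
      simp at h10
    · simp only [Sum.elim_inr] at h11 h01
      rw [h11] at h01
      simp at h01
  | result k =>
    simp only [hout, Operand.value] at *
    simp at h11

theorem sum_length_le {r K : ℕ} {k l : Fin r → ℕ} (hdisj : ∀ i j, i < j → l i ≤ k j)
    (hl : ∀ i, l i ≤ K) : ∑ i, (l i - k i) ≤ K := by
  have h : ∑ i, (l i - k i) = (Finset.univ.biUnion fun i => Finset.Ico (k i) (l i)).card := by
    rw [Finset.card_biUnion]
    · simp
    · intro i _ j _ hij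
      refine Finset.disjoint_left.2 fun x hx hx' => ?_
      rw [Finset.mem_Ico] at hx hx'
      rcases lt_or_gt_of_ne hij with h | h
      · have := hdisj i j h; omega
      · have := hdisj j i h; omega
  rw [h]
  refine (Finset.card_le_card (t := Finset.range K) fun x hx => ?_).trans (by simp)
  obtain ⟨i, -, hi⟩ := Finset.mem_biUnion.1 hx
  rw [Finset.mem_Ico] at hi
  have := hl i
  rw [Finset.mem_range]
  omega

/-- Multiplying out factor by factor serves the case s = 0, that is K ≤ 3, where no J < s exists. -/
theorem Computes.intervalProducts_naive {U₀ U₁ : Matrix (Fin m) (Fin m) 𝓐} {Z A : Set 𝓐} {ν : ℝ}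
    (hMM : MatMulBound m Z ν) (hZA : Z ⊆ A) (h0 : (0 : 𝓐) ∈ A)
    (h1 : (1 : 𝓐) ∈ A) (h₀ : entrySet U₀ ⊆ A) (h₁ : entrySet U₁ ⊆ A) {K r : ℕ} {k l : Fin r → ℕ}
    (hl : ∀ i, l i ≤ K) :
    Computes A (K + 1 + K * (m ^ 2 * 2) + ∑ i, ((l i - k i : ℕ) : ℝ) * ν)
      (⋃ i, entrySet (blockProd U₀ U₁ (l i - k i) (k i : 𝓐))) := by
  have s₁ := Computes.naturals h0 h1 K
  set T := A ∪ (fun j : ℕ => (j : 𝓐)) '' Set.Iio (K + 1)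
  have hAT : A ⊆ T := Set.subset_union_left
  have s₂ := Computes.iUnion_lt (A := T) K (c := m ^ 2 * 2)
    (B := fun x => entrySet (blockProd U₀ U₁ 1 (x : 𝓐))) fun x hx => by
      rw [blockProd_one]
      refine Computes.entrySet_affine (.inr ⟨x + 1, ?_, by simp⟩) (h₀.trans hAT) (h₁.trans hAT)
      rw [Set.mem_Iio]; omega
  set B := ⋃ x ∈ Set.Iio K, entrySet (blockProd U₀ U₁ 1 (x : 𝓐)) with hB
  have hsub : A ⊆ A ∪ B := Set.subset_union_left
  have s₃ := Computes.biUnion (A := A ∪ B) Finset.univ (f := fun i => ((l i - k i : ℕ) : ℝ) * ν)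
    (B := fun i => entrySet (blockProd U₀ U₁ (l i - k i) (k i : 𝓐))) fun i _ => by
      have := Computes.blockProd_mul (U₀ := U₀) (U₁ := U₁) hMM (hZA.trans hsub) (hsub h0)
        (hsub h1) (l i - k i) 1 (k i) fun e he => by
          have hi := hl i
          exact (Set.subset_biUnion_of_mem (u := fun x : ℕ => entrySet (blockProd U₀ U₁ 1 (x : 𝓐)))
            (show k i + e * 1 ∈ Set.Iio K by rw [Set.mem_Iio]; omega)).trans
            Set.subset_union_right
      rwa [mul_one] at this
  exact ((s₁.trans s₂).trans s₃).mono_right (by simp)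

/-- A derivation of the interval products of the generic matrix is a program for them. -/
theorem exists_program_of_computes {S : Set R} {δ : R} {r : ℕ} {k l : Fin r → ℕ}
    (hkl : ∀ i, k i ≤ l i) {c : ℝ} {A : Set ((Fin 2 × Fin m × Fin m → R) → R)}
    (hA : ∀ a ∈ A, (∃ z, (z = 0 ∨ z = 1 ∨ z ∈ insert δ S) ∧ a = fun _ => z) ∨
      ∃ i, a = fun x => x i)
    (h : Computes A c (⋃ i, entrySet (blockProd (fun a b x => x (0, a, b))
      (fun a b x => x (1, a, b)) (l i - k i) (k i : (Fin 2 × Fin m × Fin m → R) → R)))) :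
    ∃ P : StraightLineProgram R (Fin 2 × Fin m × Fin m) (Fin r × Fin m × Fin m),
      P.ConstantsIn (insert δ S) ∧ (P.cost : ℝ) ≤ c ∧
      ∀ N : Matrix (Fin m) (Fin m) R[X], (∀ a b, (N a b).natDegree ≤ 1) →
        ∀ (i : Fin r) (a b : Fin m),
          P.eval (fun q => (N q.2.1 q.2.2).coeff q.1) (i, a, b) =
            intervalProduct N (k i) (l i) a b := by
  obtain ⟨n, hn, hd⟩ := h
  obtain ⟨P, hP, hc, hE⟩ := hd.exists_program hA
    (fun q : Fin r × Fin m × Fin m => blockProd (fun a b x => x (0, a, b))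
      (fun a b x => x (1, a, b)) (l q.1 - k q.1) (k q.1 : (Fin 2 × Fin m × Fin m → R) → R)
      q.2.1 q.2.2) fun q => Set.mem_iUnion.2 ⟨q.1, mem_entrySet _ _ _⟩
  refine ⟨P, hP, le_trans (by exact_mod_cast hc) hn, fun N hN i a b => ?_⟩
  rw [hE, intervalProduct_eq_blockProd hN (hkl i)]
  let x : Fin 2 × Fin m × Fin m → R := fun q => (N q.2.1 q.2.2).coeff q.1
  have := map_blockProd (Pi.evalRingHom (fun _ => R) x)
    (fun a b x => x (0, a, b) : Matrix (Fin m) (Fin m) ((Fin 2 × Fin m × Fin m → R) → R))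
    (fun a b x => x (1, a, b)) (l i - k i) (k i)
  have := congrFun (congrFun this a) b
  rw [map_natCast] at this
  exact this

end Transfer

/-! ### The choice of the block size -/

/-- The sequence s² ρ^s tends to 0, hence is bounded; replacing s by s + 1 costs a factor 1/ρ. -/
theorem exists_bound_sq_mul_pow {ρ : ℝ} (h0 : 0 < ρ) (h1 : ρ < 1) :
    ∃ W : ℝ, 0 ≤ W ∧ ∀ s : ℕ, ((s : ℝ) + 1) ^ 2 * ρ ^ s ≤ W := by
  have h := (tendsto_pow_const_mul_const_pow_of_abs_lt_one 2
    (by rwa [abs_of_pos h0] : |ρ| < 1)).bddAbove_range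
  obtain ⟨W, hW⟩ := h
  have hW' : ∀ s : ℕ, (s : ℝ) ^ 2 * ρ ^ s ≤ W := fun s => hW ⟨s, rfl⟩
  refine ⟨W / ρ, div_nonneg (by simpa using hW' 0) h0.le, fun s => ?_⟩
  rw [le_div_iff₀ h0]
  have := hW' (s + 1)
  rw [pow_succ ρ] at this
  push_cast at this
  linarith

/-- With J = ⌊s(1-ε)⌋ both 2^J and r 2^(s-J) are O(2^(s(1-ε))), and the gain 2^(-εs) over 2^s
absorbs the factor (J + 1)². -/
theorem exists_blockSize {ε : ℝ} (hε₀ : 0 < ε) (hε₁ : ε < 1 / 2) :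
    ∃ W : ℝ, 0 ≤ W ∧ ∀ s r : ℕ, 1 ≤ s → (r : ℝ) ≤ 2 * 2 ^ (s * (1 - 2 * ε)) →
      ∃ J < s, ((J : ℝ) + 1) ^ 2 * (r * 2 ^ (s - J) + 2 ^ J) ≤ W * 2 ^ s := by
  obtain ⟨W, hW0, hW⟩ := exists_bound_sq_mul_pow (ρ := (2 : ℝ) ^ (-ε)) (by positivity)
    (Real.rpow_lt_one_of_one_lt_of_neg (by norm_num) (by linarith))
  refine ⟨5 * W, by positivity, fun s r hs hr => ?_⟩
  have hs' : (1 : ℝ) ≤ s := by exact_mod_cast hs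
  have hpos : 0 ≤ (s : ℝ) * (1 - ε) := by nlinarith
  set J := ⌊(s : ℝ) * (1 - ε)⌋₊ with hJ
  have hJle : (J : ℝ) ≤ s * (1 - ε) := Nat.floor_le hpos
  have hJlt : (s : ℝ) * (1 - ε) < J + 1 := Nat.lt_floor_add_one _
  have hJs : J < s := by
    have : (J : ℝ) < s := by nlinarith
    exact_mod_cast this
  refine ⟨J, hJs, ?_⟩
  have two : (1 : ℝ) ≤ 2 := by norm_num
  have h₁ : (2 : ℝ) ^ J ≤ 2 ^ (s * (1 - ε)) := by
    rw [← Real.rpow_natCast]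
    exact Real.rpow_le_rpow_of_exponent_le two hJle
  have h₂ : (2 : ℝ) ^ (s - J) ≤ 2 ^ (s * ε + 1) := by
    rw [← Real.rpow_natCast, Nat.cast_sub hJs.le]
    exact Real.rpow_le_rpow_of_exponent_le two (by linarith)
  have h₃ : (r : ℝ) * 2 ^ (s - J) ≤ 4 * 2 ^ (s * (1 - ε)) := by
    calc (r : ℝ) * 2 ^ (s - J) ≤ 2 * 2 ^ (s * (1 - 2 * ε)) * 2 ^ (s * ε + 1) := by gcongr
      _ = 4 * ((2 : ℝ) ^ (s * (1 - 2 * ε)) * 2 ^ (s * ε)) := by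
        rw [Real.rpow_add_one (by norm_num)]; ring
      _ = 4 * 2 ^ (s * (1 - ε)) := by
        rw [← Real.rpow_add (by norm_num)]; congr 2; ring
  have h₄ : (2 : ℝ) ^ (s * (1 - ε)) = (2 ^ (-ε)) ^ s * 2 ^ s := by
    rw [← Real.rpow_natCast (2 ^ (-ε)), ← Real.rpow_mul (by norm_num), ← Real.rpow_natCast 2 s,
      ← Real.rpow_add (by norm_num)]
    congr 1; ring
  have h₅ : ((J : ℝ) + 1) ^ 2 ≤ ((s : ℝ) + 1) ^ 2 := by
    have : (J : ℝ) ≤ s := by exact_mod_cast hJs.le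
    gcongr
  calc ((J : ℝ) + 1) ^ 2 * (r * 2 ^ (s - J) + 2 ^ J)
      ≤ ((s : ℝ) + 1) ^ 2 * (4 * 2 ^ (s * (1 - ε)) + 2 ^ (s * (1 - ε))) := by gcongr
    _ = 5 * (((s : ℝ) + 1) ^ 2 * (2 ^ (-ε)) ^ s) * 2 ^ s := by rw [h₄]; ring
    _ ≤ 5 * W * 2 ^ s := by
      have := hW s
      gcongr

theorem rpow_half_sub_le {ε : ℝ} (hε₀ : 0 < ε) (hε₁ : ε < 1 / 2) {K s : ℕ}
    (hK : K < 4 * 2 ^ s * 2 ^ s) :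
    (K : ℝ) ^ (1 / 2 - ε) ≤ 2 * 2 ^ (s * (1 - 2 * ε)) := by
  have h₁ : (K : ℝ) ≤ 2 ^ (2 * ((s : ℝ) + 1)) := by
    have : (2 : ℝ) ^ (2 * ((s : ℝ) + 1)) = 4 * 2 ^ s * 2 ^ s := by
      rw [show 2 * ((s : ℝ) + 1) = (s : ℝ) + s + 2 by ring, Real.rpow_add (by norm_num),
        Real.rpow_add (by norm_num), Real.rpow_natCast]
      norm_num
      ring
    rw [this]
    exact_mod_cast hK.le
  calc (K : ℝ) ^ (1 / 2 - ε) ≤ ((2 : ℝ) ^ (2 * ((s : ℝ) + 1))) ^ (1 / 2 - ε) :=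
        Real.rpow_le_rpow (Nat.cast_nonneg _) h₁ (by linarith)
    _ = 2 ^ (s * (1 - 2 * ε) + (1 - 2 * ε)) := by
        rw [← Real.rpow_mul (by norm_num)]; congr 1; ring
    _ ≤ 2 ^ (s * (1 - 2 * ε) + 1) :=
        Real.rpow_le_rpow_of_exponent_le (by norm_num) (by linarith)
    _ = 2 * 2 ^ (s * (1 - 2 * ε)) := by rw [Real.rpow_add_one (by norm_num)]; ring

/-! ### The theorem -/

theorem mainTheorem3 (ε : ℝ) (hε₀ : 0 < ε) (hε₁ : ε < 1 / 2) (A : ℝ) :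
    ∃ C : ℝ, ∀ (R : Type u) [CommRing R] (S : Set R) (M MM : ℕ → ℕ),
      IsPolyMulCost S M → IsMatMulCost S MM → RegularGrowth A M →
      ∀ (m K r : ℕ) (k l : Fin r → ℕ), 1 ≤ K →
        (∀ i, k i < l i) → (∀ i j, i < j → l i ≤ k j) → (∀ i, l i ≤ K) →
        (r : ℝ) < (K : ℝ) ^ (1 / 2 - ε) →
        (∀ n : ℕ, 2 ≤ n → n ≤ 2 ^ Nat.log 4 K + 1 → IsUnit (n : R)) →
        ∀ δ : R, δ * bgsD (1 : R) (2 ^ Nat.log 4 K) (2 ^ Nat.log 4 K) = 1 →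
          ∃ P : StraightLineProgram R (Fin 2 × Fin m × Fin m) (Fin r × Fin m × Fin m),
            P.ConstantsIn (insert δ S) ∧
            (P.cost : ℝ) ≤ C * (MM m * Real.sqrt K + (m : ℝ) ^ 2 * M (Nat.sqrt K)) ∧
            ∀ N : Matrix (Fin m) (Fin m) R[X], (∀ a b, (N a b).natDegree ≤ 1) →
              ∀ (i : Fin r) (a b : Fin m),
                P.eval (fun q => (N q.2.1 q.2.2).coeff q.1) (i, a, b) =
                  intervalProduct N (k i) (l i) a b := by
  obtain ⟨W, hW0, hW⟩ := exists_blockSize hε₀ hε₁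
  refine ⟨(400 + 24 * W) * max A 1, ?_⟩
  intro R _ S M MM hMul hMatMul hReg m K r k l hK hkl hdisj hl hr _ δ hδ
  have hC : 0 ≤ (400 + 24 * W) * max A 1 :=
    mul_nonneg (by positivity) (zero_le_one.trans (le_max_right _ _))
  have hRHS : 0 ≤ (400 + 24 * W) * max A 1 *
      (MM m * Real.sqrt K + (m : ℝ) ^ 2 * M (Nat.sqrt K)) := mul_nonneg hC (by positivity)
  rcases Nat.eq_zero_or_pos m with rfl | hm
  · exact ⟨⟨[], fun _ => .const 0⟩, ⟨by simp, fun _ => .inl rfl⟩, by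
      simpa [StraightLineProgram.cost] using hRHS, fun N _ i a => a.elim0⟩
  -- Over the zero ring multiplication may cost nothing, and 1 ≤ μ below could fail; the empty
  -- program is correct there.
  rcases subsingleton_or_nontrivial R with hR | hR
  · exact ⟨⟨[], fun _ => .const 0⟩, ⟨by simp, fun _ => .inl rfl⟩, by
      simpa [StraightLineProgram.cost] using hRHS, fun N _ i a b => Subsingleton.elim _ _⟩
  set s := Nat.log 4 K with hs
  set D := Nat.sqrt K with hD
  have h4 : (4 : ℕ) ^ s = 2 ^ s * 2 ^ s := by rw [← mul_pow]; norm_num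
  have hsK : 2 ^ s * 2 ^ s ≤ K := by rw [← h4]; exact Nat.pow_log_le_self 4 (by omega)
  have hKs : K < 4 * 2 ^ s * 2 ^ s := by
    have := Nat.lt_pow_succ_log_self (b := 4) (by norm_num) K
    rw [← hs, pow_succ, h4] at this
    linarith
  have hsD : 2 ^ s ≤ D := Nat.le_sqrt.2 hsK
  have hDpos : 1 ≤ D := Nat.one_le_two_pow.trans hsD
  have hD' : (0 : ℝ) < D := by exact_mod_cast hDpos
  -- By regular growth, one constant μ bounds M(d)/d for all d ≤ D = ⌊√K⌋. All multiplications take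
  -- place in these degrees, and μD = A · M(D) gives the final bound.
  set μ : ℝ := A * (M D / D) with hμdef
  have hμM : ∀ d, 1 ≤ d → d ≤ D → (M d : ℝ) ≤ μ * d := fun d h1 hd => by
    have hd' : (0 : ℝ) < d := by exact_mod_cast h1
    exact (div_le_iff₀ hd').1 (hReg.superlinear d D h1 hd)
  have hμ : 1 ≤ μ := by
    have h₁ := hμM 1 le_rfl hDpos
    have h₂ : (1 : ℝ) ≤ M 1 := by exact_mod_cast one_le_polyMulCost hMul
    simpa using h₂.trans h₁
  let Z : Set ((Fin 2 × Fin m × Fin m → R) → R) := {a | ∃ c, (c = 0 ∨ c = 1 ∨ c ∈ S) ∧ a = fun _ => c}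
  have hZ : ∀ c, (c = 0 ∨ c = 1 ∨ c ∈ S) → (fun _ => c) ∈ Z := fun c hc => ⟨c, hc, rfl⟩
  let B : Set ((Fin 2 × Fin m × Fin m → R) → R) := {a | (∃ c, (c = 0 ∨ c = 1 ∨ c ∈ insert δ S) ∧
    a = fun _ => c) ∨ ∃ i, a = fun x => x i}
  have hZB : Z ⊆ B := by
    rintro _ ⟨c, hc, rfl⟩
    exact .inl ⟨c, hc.imp_right (Or.imp_right (Set.mem_insert_of_mem δ)), rfl⟩
  have hM := hMul.polyMulBound hμM hZ
  have hMM := hMatMul.matMulBound m hZ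
  have hν : (0 : ℝ) ≤ MM m := Nat.cast_nonneg _
  have h0 : (0 : (Fin 2 × Fin m × Fin m → R) → R) ∈ B := .inl ⟨0, .inl rfl, rfl⟩
  have h1 : (1 : (Fin 2 × Fin m × Fin m → R) → R) ∈ B := .inl ⟨1, .inr (.inl rfl), rfl⟩
  have hU₀ : entrySet (fun a b x => x (0, a, b) :
      Matrix (Fin m) (Fin m) ((Fin 2 × Fin m × Fin m → R) → R)) ⊆ B := by
    rintro _ ⟨q, rfl⟩
    exact .inr ⟨(0, q.1, q.2), rfl⟩
  have hU₁ : entrySet (fun a b x => x (1, a, b) :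
      Matrix (Fin m) (Fin m) ((Fin 2 × Fin m × Fin m → R) → R)) ⊆ B := by
    rintro _ ⟨q, rfl⟩
    exact .inr ⟨(1, q.1, q.2), rfl⟩
  have hsum := sum_length_le hdisj hl
  have key : Computes B ((400 + 24 * W) * (m ^ 2 * μ * 2 ^ s + MM m * 2 ^ s))
      (⋃ i, entrySet (blockProd (fun a b x => x (0, a, b)) (fun a b x => x (1, a, b)) (l i - k i)
        (k i : (Fin 2 × Fin m × Fin m → R) → R))) := by
    rcases Nat.eq_zero_or_pos s with hs0 | hs1
    · refine (Computes.intervalProducts_naive hMM hZB h0 h1 hU₀ hU₁ hl).mono_cost ?_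
      rw [hs0] at hKs
      have hK3 : (K : ℝ) ≤ 3 := by exact_mod_cast (by omega : K ≤ 3)
      have hsum' : ∑ i, ((l i - k i : ℕ) : ℝ) ≤ 3 := le_trans (by exact_mod_cast hsum) hK3
      have hm' : (1 : ℝ) ≤ (m : ℝ) ^ 2 := one_le_pow₀ (by exact_mod_cast hm)
      rw [← Finset.sum_mul, hs0, pow_zero, mul_one, mul_one]
      have e₁ := mul_le_mul_of_nonneg_right hsum' hν
      have e₂ := mul_le_mul_of_nonneg_right hK3 (by positivity : (0 : ℝ) ≤ m ^ 2 * 2)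
      have e₃ : (m : ℝ) ^ 2 ≤ m ^ 2 * μ := le_mul_of_one_le_right (by positivity) hμ
      have e₄ : 0 ≤ W * ((m : ℝ) ^ 2 * μ + MM m) := mul_nonneg hW0 (by positivity)
      linarith
    · obtain ⟨J, hJ, hJW⟩ := hW s r hs1 (hr.le.trans (rpow_half_sub_le hε₀ hε₁ hKs))
      refine Computes.intervalProducts hM hμ hMM hν hZB h0 h1 (δ := fun _ => δ)
        (.inl ⟨δ, .inr (.inr (Set.mem_insert _ _)), rfl⟩) ?_ hU₀ hU₁ hm hJ hsD
        (fun i => (hkl i).le) (fun i => (hl i).trans_lt hKs) (hsum.trans hKs.le) hJW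
      -- δ enters as a constant function; that it inverts D(1, 2^s, 2^s) is checked at every input
      -- x.
      funext x
      have := map_bgsD (Pi.evalRingHom (fun _ => R) x) 1 (2 ^ s) (2 ^ s)
      rw [map_one, map_pow, map_ofNat] at this
      rw [← this] at hδ
      exact hδ
  obtain ⟨P, hP, hc, hE⟩ := exists_program_of_computes (fun i => (hkl i).le) (fun a ha => ha) key
  refine ⟨P, hP, hc.trans ?_, hE⟩
  have ht : (2 : ℝ) ^ s ≤ D := by exact_mod_cast hsD
  have ht' : (2 : ℝ) ^ s ≤ Real.sqrt K := ht.trans Real.nat_sqrt_le_real_sqrt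
  have hμD : μ * D = A * M D := by rw [hμdef]; field_simp
  have f₁ : (m : ℝ) ^ 2 * μ * 2 ^ s ≤ max A 1 * ((m : ℝ) ^ 2 * M D) := by
    calc (m : ℝ) ^ 2 * μ * 2 ^ s ≤ m ^ 2 * μ * D := by gcongr
      _ = A * (m ^ 2 * M D) := by rw [mul_assoc, hμD]; ring
      _ ≤ _ := mul_le_mul_of_nonneg_right (le_max_left _ _) (by positivity)
  have f₂ : (MM m : ℝ) * 2 ^ s ≤ max A 1 * (MM m * Real.sqrt K) := by
    calc (MM m : ℝ) * 2 ^ s ≤ MM m * Real.sqrt K := by gcongr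
      _ ≤ _ := le_mul_of_one_le_left (by positivity) (le_max_right _ _)
  calc (400 + 24 * W) * (m ^ 2 * μ * 2 ^ s + MM m * 2 ^ s)
      ≤ (400 + 24 * W) * (max A 1 * ((m : ℝ) ^ 2 * M D) + max A 1 * (MM m * Real.sqrt K)) := by
        gcongr
    _ = _ := by ring
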